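/- We work in many-sorted first-order logic with equality. A signature $\Sigma$ consists of a non-empty set $\mathcal S_\Sigma$ of sorts, a set of function symbols and a set of predicate symbols (each with a finite arity of sorts), the latter including an equality symbol for every sort; it is countable if the set of all its sorts and symbols is countable. There are countably infinitely many variables of each sort. A $\Sigma$-interpretation $\mathcal A$ gives every sort $\sigma$ a non-empty domain $\sigma^{\mathcal A}$, interprets the symbols (equality as identity), and assigns to every variable $x$ of sort $\sigma$ an element $x^{\mathcal A}\in\sigma^{\mathcal A}$. A $\Sigma$-theory $\mathcal T$ is the class of all $\Sigma$-interpretations ($\mathcal T$-interpretations) satisfying a given set of sentences; a formula is $\mathcal T$-satisfiable if some $\mathcal T$-interpretation satisfies it, and two formulas are $\mathcal T$-equivalent if they are satisfied by the same $\mathcal T$-interpretations. $\mathrm{vars}(\varphi)$ is the set of free variables of $\varphi$, and $\mathrm{vars}_\sigma(\varphi)$ the set of those of sort $\sigma$; for a set $X$ of variables, $X^{\mathcal A}=\{x^{\mathcal A} : x\in X\}$. Let $S\subseteq\mathcal S_\Sigma$. With respect to $S$, the theory $\mathcal T$ - is *stably infinite* if every $\mathcal T$-satisfiable quantifier-free formula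 is satisfied by a $\mathcal T$-interpretation $\mathcal A$ with $|\sigma^{\mathcal A}|\ge\aleph_0$ for all $\sigma\in S$; - is *stably finite* if for every quantifier-free $\varphi$ and $\mathcal T$-interpretation $\mathcal A\vDash\varphi$ there is a $\mathcal T$-interpretation $\mathcal B\vDash\varphi$ with $|\sigma^{\mathcal B}|<\aleph_0$ and $|\sigma^{\mathcal B}|\le|\sigma^{\mathcal A}|$ for all $\sigma\in S$; - is *smooth* if for every quantifier-free $\varphi$, $\mathcal T$-interpretation $\mathcal A\vDash\varphi$, and function $\kappa$ from $S$ to the cardinals with $\kappa(\sigma)\ge|\sigma^{\mathcal A}|$ for all $\sigma\in S$, there is a $\mathcal T$-interpretation $\mathcal B\vDash\varphi$ with $|\sigma^{\mathcal B}|=\kappa(\sigma)$ for all $\sigma\in S$; it is *finitely smooth* if this holds for all such $\kappa$ with $\kappa(\sigma)<\aleph_0$ for all $\sigma\in S$; - has a *strong pre-witness* if there is a (not necessarily computable) function $\mathit{wit}$ from quantifier-free formulas to quantifier-free formulas such that for every quantifier-free $\varphi$: (a) $\varphi$ and $\exists\overrightarrow{x}\,\mathit{wit}(\varphi)$ are $\mathcal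 T$-equivalent, where $\overrightarrow{x}=\mathrm{vars}(\mathit{wit}(\varphi))\setminus\mathrm{vars}(\varphi)$; (b) if $\mathit{wit}(\varphi)$ is $\mathcal T$-satisfiable, there is a $\mathcal T$-interpretation $\mathcal A\vDash\varphi$ with $\sigma^{\mathcal A}=\mathrm{vars}_\sigma(\mathit{wit}(\varphi))^{\mathcal A}$ for each $\sigma\in S$; (c) for every finite set $V$ of variables with sorts in $S$ and every arrangement $\delta_V$ on $V$, if $\mathit{wit}(\varphi)\wedge\delta_V$ is $\mathcal T$-satisfiable, there is a $\mathcal T$-interpretation $\mathcal A\vDash\mathit{wit}(\varphi)\wedge\delta_V$ with $\sigma^{\mathcal A}=\mathrm{vars}_\sigma(\mathit{wit}(\varphi)\wedge\delta_V)^{\mathcal A}$ for each $\sigma\in S$. Here the arrangement induced by an equivalence relation $E$ on $V$ relating only variables of the same sort is the conjunction, over all $x,y\in V$ of the same sort, of the literals $x=y$ if $xEy$ and $\neg(x=y)$ otherwise. **Theorem.** Let $\mathcal T$ be a $\Sigma$-theory and $S\subseteq\mathcal S_\Sigma$ a finite set of sorts. Then the following are equivalent: 1. $\mathcal T$ is stably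 finite and finitely smooth with respect to $S$; 2. $\mathcal T$ is stably infinite and has a strong pre-witness with respect to $S$. Furthermore, the following are equivalent: 3. $\mathcal T$ is stably finite and smooth with respect to $S$; 4. $\mathcal T$ is smooth and has a strong pre-witness with respect to $S$. If $\Sigma$ is countable, then all four conditions are equivalent. -/

import Mathlib

universe u

namespace ManySorted

/-- A many-sorted signature. Function and predicate symbols have finite arities (arity `0` is
allowed). The equality symbols, one for each sort, are not listed in `Preds`: they are a primitive
of the language, see `Formula.equal`. -/
structure Signature where
  Sorts : Type u
  sorts_nonempty : Nonempty Sorts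
  Funcs : Type u
  funArity : Funcs → ℕ
  funDom : (f : Funcs) → Fin (funArity f) → Sorts
  funCod : Funcs → Sorts
  Preds : Type u
  predArity : Preds → ℕ
  predDom : (P : Preds) → Fin (predArity P) → Sorts

/-- The set of all sorts, function symbols and predicate symbols is countable (the equality symbols
are indexed by the sorts and do not change this). -/
def Signature.IsCountable (Sg : Signature.{u}) : Prop :=
  Countable (Sg.Sorts ⊕ Sg.Funcs ⊕ Sg.Preds)

/-- The variables: a countably infinite supply `⟨σ, 0⟩, ⟨σ, 1⟩, …` for every sort `σ`. -/
abbrev Var (Sg : Signature.{u}) : Type u := Σ _ : Sg.Sorts, ℕ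

noncomputable instance (Sg : Signature.{u}) : DecidableEq (Var Sg) := Classical.decEq _

/-- `Term Sg σ` is the type of terms of sort `σ`. -/
inductive Term (Sg : Signature.{u}) : Sg.Sorts → Type u
  | var (σ : Sg.Sorts) (n : ℕ) : Term Sg σ
  | app (f : Sg.Funcs) (args : (i : Fin (Sg.funArity f)) → Term Sg (Sg.funDom f i)) :
      Term Sg (Sg.funCod f)

/-- First-order formulas with equality; the other connectives are defined from these. -/
inductive Formula (Sg : Signature.{u}) : Type u
  | falsum : Formula Sg
  | equal {σ : Sg.Sorts} (s t : Term Sg σ) : Formula Sg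
  | pred (P : Sg.Preds) (args : (i : Fin (Sg.predArity P)) → Term Sg (Sg.predDom P i)) : Formula Sg
  | imp (φ ψ : Formula Sg) : Formula Sg
  | all (x : Var Sg) (φ : Formula Sg) : Formula Sg

variable {Sg : Signature.{u}}

noncomputable def Term.vars : {σ : Sg.Sorts} → Term Sg σ → Finset (Var Sg)
  | _, .var σ n => {⟨σ, n⟩}
  | _, .app _ args => Finset.univ.biUnion fun i => (args i).vars

namespace Formula

def neg (φ : Formula Sg) : Formula Sg := imp φ falsum

def verum : Formula Sg := neg falsum

def and (φ ψ : Formula Sg) : Formula Sg := neg (imp φ (neg ψ))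

def ex (x : Var Sg) (φ : Formula Sg) : Formula Sg := neg (all x (neg φ))

/-- The conjunction of a list of formulas (`⊤` for the empty list). -/
def conj (l : List (Formula Sg)) : Formula Sg := l.foldr and verum

/-- `∃ x⃗. φ`, where `x⃗` enumerates the finite set `V` of variables. -/
noncomputable def exs (V : Finset (Var Sg)) (φ : Formula Sg) : Formula Sg := V.toList.foldr ex φ

/-- The set of free variables of a formula. -/
noncomputable def vars : Formula Sg → Finset (Var Sg)
  | falsum => ∅
  | equal s t => s.vars ∪ t.vars
  | pred _ args => Finset.univ.biUnion fun i => (args i).vars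
  | imp φ ψ => φ.vars ∪ ψ.vars
  | all x φ => φ.vars.erase x

def IsSentence (φ : Formula Sg) : Prop := φ.vars = ∅

/-- Quantifier-free formulas. -/
def IsQF : Formula Sg → Prop
  | falsum => True
  | equal _ _ => True
  | pred _ _ => True
  | imp φ ψ => φ.IsQF ∧ ψ.IsQF
  | all _ _ => False

end Formula

/-- The set of quantifier-free formulas over the signature. -/
def QF (Sg : Signature.{u}) : Type u := {φ : Formula Sg // φ.IsQF}

/-- A structure: every sort has a non-empty domain. -/
structure Struct (Sg : Signature.{u}) where
  dom : Sg.Sorts → Type u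
  dom_nonempty : ∀ σ, Nonempty (dom σ)
  func : (f : Sg.Funcs) → ((i : Fin (Sg.funArity f)) → dom (Sg.funDom f i)) → dom (Sg.funCod f)
  pred : (P : Sg.Preds) → Set ((i : Fin (Sg.predArity P)) → dom (Sg.predDom P i))

/-- The value of a term under an assignment `v` of elements to variables. -/
def Term.value (M : Struct Sg) (v : (x : Var Sg) → M.dom x.1) :
    {σ : Sg.Sorts} → Term Sg σ → M.dom σ
  | _, .var σ n => v ⟨σ, n⟩
  | _, .app f args => M.func f fun i => (args i).value M v

/-- Satisfaction of a formula under an assignment `v` of elements to variables. -/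
def Formula.Holds (M : Struct Sg) : ((x : Var Sg) → M.dom x.1) → Formula Sg → Prop
  | _, .falsum => False
  | v, .equal s t => s.value M v = t.value M v
  | v, .pred P args => (fun i => (args i).value M v) ∈ M.pred P
  | v, .imp φ ψ => φ.Holds M v → ψ.Holds M v
  | v, .all x φ => ∀ a : M.dom x.1, φ.Holds M (Function.update v x a)

/-- An interpretation: a structure together with an assignment of elements to variables. -/
structure Interp (Sg : Signature.{u}) extends Struct Sg where
  val : (x : Var Sg) → dom x.1

def Interp.Sat (A : Interp Sg) (φ : Formula Sg) : Prop := φ.Holds A.toStruct A.val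

/-- `vars_σ(φ)^A`: the set of values in `A` of the free variables of `φ` of sort `σ`. -/
def Interp.varValues (A : Interp Sg) (φ : Formula Sg) (σ : Sg.Sorts) : Set (A.dom σ) :=
  {a | ∃ n : ℕ, (⟨σ, n⟩ : Var Sg) ∈ φ.vars ∧ A.val ⟨σ, n⟩ = a}

/-- A theory, given by its axiomatization. -/
structure Theory (Sg : Signature.{u}) where
  Ax : Set (Formula Sg)
  isSentence : ∀ φ ∈ Ax, φ.IsSentence

namespace Theory

/-- `A` is a `T`-interpretation. -/
def Models (T : Theory Sg) (A : Interp Sg) : Prop := ∀ φ ∈ T.Ax, A.Sat φ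

/-- `φ` is `T`-satisfiable. -/
def Satisfiable (T : Theory Sg) (φ : Formula Sg) : Prop := ∃ A, T.Models A ∧ A.Sat φ

/-- `φ` and `ψ` are `T`-equivalent. -/
def Equivalent (T : Theory Sg) (φ ψ : Formula Sg) : Prop :=
  ∀ A, T.Models A → (A.Sat φ ↔ A.Sat ψ)

def StablyInfinite (T : Theory Sg) (S : Set Sg.Sorts) : Prop :=
  ∀ φ : Formula Sg, φ.IsQF → T.Satisfiable φ →
    ∃ A, T.Models A ∧ A.Sat φ ∧ ∀ σ ∈ S, Cardinal.aleph0 ≤ Cardinal.mk (A.dom σ)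

def StablyFinite (T : Theory Sg) (S : Set Sg.Sorts) : Prop :=
  ∀ φ : Formula Sg, φ.IsQF → ∀ A, T.Models A → A.Sat φ →
    ∃ B, T.Models B ∧ B.Sat φ ∧ ∀ σ ∈ S, Cardinal.mk (B.dom σ) < Cardinal.aleph0 ∧
      Cardinal.mk (B.dom σ) ≤ Cardinal.mk (A.dom σ)

def Smooth (T : Theory Sg) (S : Set Sg.Sorts) : Prop :=
  ∀ φ : Formula Sg, φ.IsQF → ∀ A, T.Models A → A.Sat φ →
    ∀ κ : S → Cardinal.{u}, (∀ σ : S, Cardinal.mk (A.dom σ) ≤ κ σ) →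
      ∃ B, T.Models B ∧ B.Sat φ ∧ ∀ σ : S, Cardinal.mk (B.dom σ) = κ σ

def FinitelySmooth (T : Theory Sg) (S : Set Sg.Sorts) : Prop :=
  ∀ φ : Formula Sg, φ.IsQF → ∀ A, T.Models A → A.Sat φ →
    ∀ κ : S → Cardinal.{u}, (∀ σ : S, Cardinal.mk (A.dom σ) ≤ κ σ) →
      (∀ σ : S, κ σ < Cardinal.aleph0) →
      ∃ B, T.Models B ∧ B.Sat φ ∧ ∀ σ : S, Cardinal.mk (B.dom σ) = κ σ

end Theory

/-- `E` relates only variables of the same sort. -/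
def RespectsSorts (V : Finset (Var Sg)) (E : Setoid V) : Prop :=
  ∀ x y : V, E x y → x.1.1 = y.1.1

open Classical in
/-- The arrangement induced by `E` on `V`: the conjunction of the literals `x = y` if `E x y` and
`¬ (x = y)` if not `E x y`, over all pairs `x`, `y` in `V` that have the same sort (an equation
between variables of different sorts is not a formula). -/
noncomputable def arrangement (V : Finset (Var Sg)) (E : Setoid V) : Formula Sg :=
  Formula.conj <|
    (Finset.univ.filter fun p : V × V => p.1.1.1 = p.2.1.1).toList.map fun p =>
      let e : Formula Sg := Formula.equal (Term.var p.1.1.1 p.1.1.2) (Term.var p.1.1.1 p.2.1.2)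
      if E p.1 p.2 then e else e.neg

namespace Theory

/-- A witness of `T` with respect to `S`, without the requirement of computability. -/
def IsPreWitness (T : Theory Sg) (S : Set Sg.Sorts) (wit : QF Sg → QF Sg) : Prop :=
  ∀ φ : QF Sg,
    T.Equivalent φ.1 (Formula.exs ((wit φ).1.vars \ φ.1.vars) (wit φ).1) ∧
    (T.Satisfiable (wit φ).1 →
      ∃ A, T.Models A ∧ A.Sat φ.1 ∧ ∀ σ ∈ S, A.varValues (wit φ).1 σ = Set.univ)

/-- A strong witness of `T` with respect to `S`, without the requirement of computability. -/
def IsStrongPreWitness (T : Theory Sg) (S : Set Sg.Sorts) (wit : QF Sg → QF Sg) : Prop :=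
  T.IsPreWitness S wit ∧
    ∀ φ : QF Sg, ∀ V : Finset (Var Sg), (∀ x ∈ V, x.1 ∈ S) →
      ∀ E : Setoid V, RespectsSorts V E →
        T.Satisfiable ((wit φ).1.and (arrangement V E)) →
          ∃ A, T.Models A ∧ A.Sat ((wit φ).1.and (arrangement V E)) ∧
            ∀ σ ∈ S, A.varValues ((wit φ).1.and (arrangement V E)) σ = Set.univ

def HasStrongPreWitness (T : Theory Sg) (S : Set Sg.Sorts) : Prop :=
  ∃ wit : QF Sg → QF Sg, T.IsStrongPreWitness S wit

end Theory

end ManySorted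

universe v w

namespace ManySorted

/-! ### Assignments, derived connectives and free variables -/

variable {Sg : Signature.{u}}

/-! The arrangement that a model induces on a finite set of variables fixes how many values these
variables take, and clause (c) of a strong pre-witness returns a model with exactly that many
elements in the sorts of S. Applied to the S-variables of the witness, this gives stable finiteness.
Applied after passing to a model infinite in all sorts of S, where spare variables can be made to
take exactly κ(σ) values, it gives finite smoothness.

Conversely, by Dickson's lemma the size vectors of the finite models of φ with a given arrangement
of vars_S(φ) have finitely many minimal elements, so a single bound K works for all arrangements.
The witness is φ together with the disjunction of those arrangements, of vars_S(φ) and K fresh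
variables per sort, that have a model of φ covered by these variables. Every model of φ is at least
as large as such a small model and can imitate its arrangement (`exists_wit`); finite smoothness
enlarges the small model to absorb any further arrangement (`coverFormula_strong`). Stable
infiniteness follows by an ultraproduct of ever larger models.

For full smoothness the difficulty is to realise different infinite cardinals at once: terms fed
with the generators of a large sort may produce too many elements of a small one. The approximating
models are finite and their sizes can be chosen independently. If these sizes grow fast along κ,
Ramsey's theorem provides generators for which a term of sort j depends, in sorts with larger κ,
only on the number of generators used. The Skolem hull of such generators in an ultraproduct has
exactly κ(j) elements of sort j when κ(j) is infinite (`exists_hull_mk_eq`). Sorts with finite κ are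
covered by fixed variables and keep their size (`mk_hull_of_covered`). -/

theorem Term.value_congr {M : Struct Sg} {v w : (x : Var Sg) → M.dom x.1} {σ : Sg.Sorts}
    (t : Term Sg σ) (h : ∀ x ∈ t.vars, v x = w x) : t.value M v = t.value M w := by
  induction t with
  | var σ n => exact h _ (by simp [Term.vars])
  | app f args ih =>
    simp only [Term.value]
    congr 1
    funext i
    exact ih i fun x hx => h x (by
      simp only [Term.vars, Finset.mem_biUnion, Finset.mem_univ, true_and]
      exact ⟨i, hx⟩)

theorem Formula.holds_congr {M : Struct Sg} (φ : Formula Sg) {v w : (x : Var Sg) → M.dom x.1}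
    (h : ∀ x ∈ φ.vars, v x = w x) : φ.Holds M v ↔ φ.Holds M w := by
  induction φ generalizing v w with
  | falsum => rfl
  | equal s t =>
    simp only [Formula.Holds]
    rw [s.value_congr fun x hx => h x (by simp [Formula.vars, hx]),
      t.value_congr fun x hx => h x (by simp [Formula.vars, hx])]
  | pred P args =>
    simp only [Formula.Holds]
    have : (fun i => (args i).value M v) = fun i => (args i).value M w := by
      funext i
      exact (args i).value_congr fun x hx => h x (by
        simp only [Formula.vars, Finset.mem_biUnion, Finset.mem_univ, true_and]
        exact ⟨i, hx⟩)
    rw [this]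
  | imp φ ψ ih₁ ih₂ =>
    simp only [Formula.Holds]
    rw [ih₁ fun x hx => h x (by simp [Formula.vars, hx]),
      ih₂ fun x hx => h x (by simp [Formula.vars, hx])]
  | all x φ ih =>
    simp only [Formula.Holds]
    refine forall_congr' fun a => ih fun y hy => ?_
    by_cases hxy : y = x
    · subst hxy; simp
    · rw [Function.update_of_ne hxy, Function.update_of_ne hxy]
      exact h y (by simp [Formula.vars, hxy, hy])

/-- The interpretation obtained from `A` by changing the assignment to `v`. -/
abbrev Interp.withVal (A : Interp Sg) (v : (x : Var Sg) → A.dom x.1) : Interp Sg :=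
  { A with val := v }

theorem Interp.sat_withVal_iff {A : Interp Sg} {v : (x : Var Sg) → A.dom x.1} {φ : Formula Sg}
    (h : ∀ x ∈ φ.vars, v x = A.val x) : (A.withVal v).Sat φ ↔ A.Sat φ :=
  φ.holds_congr h

theorem Theory.Models.withVal {T : Theory Sg} {A : Interp Sg} (h : T.Models A)
    (v : (x : Var Sg) → A.dom x.1) : T.Models (A.withVal v) := fun φ hφ =>
  (Interp.sat_withVal_iff fun x hx => by
    have := T.isSentence φ hφ
    rw [Formula.IsSentence] at this
    simp [this] at hx).2 (h φ hφ)

section Connectives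

variable {M : Struct Sg} {v : (x : Var Sg) → M.dom x.1}

@[simp] theorem Formula.holds_neg {φ : Formula Sg} : φ.neg.Holds M v ↔ ¬ φ.Holds M v := Iff.rfl

@[simp] theorem Formula.holds_verum : (verum : Formula Sg).Holds M v := fun h => h

@[simp] theorem Formula.holds_and {φ ψ : Formula Sg} :
    (φ.and ψ).Holds M v ↔ φ.Holds M v ∧ ψ.Holds M v := by
  simp only [Formula.and, Formula.neg, Formula.Holds]
  tauto

@[simp] theorem Formula.holds_ex {φ : Formula Sg} {x : Var Sg} :
    (Formula.ex x φ).Holds M v ↔ ∃ a, φ.Holds M (Function.update v x a) := by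
  simp [Formula.ex, Formula.neg, Formula.Holds]

theorem Formula.holds_conj {l : List (Formula Sg)} :
    (conj l).Holds M v ↔ ∀ φ ∈ l, φ.Holds M v := by
  induction l with
  | nil => simp [conj]
  | cons φ l ih =>
    have : conj (φ :: l) = φ.and (conj l) := rfl
    simp [this, ih]

theorem Formula.holds_foldr_ex {l : List (Var Sg)} {φ : Formula Sg} :
    (l.foldr ex φ).Holds M v ↔ ∃ w : (x : Var Sg) → M.dom x.1,
      (∀ x ∉ l, w x = v x) ∧ φ.Holds M w := by
  induction l generalizing v with
  | nil =>
    constructor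
    · exact fun h => ⟨v, fun _ _ => rfl, h⟩
    · rintro ⟨w, hw, h⟩
      rwa [show v = w from funext fun x => (hw x (by simp)).symm]
  | cons y l ih =>
    simp only [List.foldr_cons, holds_ex, ih]
    constructor
    · rintro ⟨a, w, hw, h⟩
      refine ⟨w, fun x hx => ?_, h⟩
      simp only [List.mem_cons, not_or] at hx
      rw [hw x hx.2, Function.update_of_ne hx.1]
    · rintro ⟨w, hw, h⟩
      refine ⟨w y, w, fun x hx => ?_, h⟩
      by_cases hxy : x = y
      · subst hxy; simp
      · rw [Function.update_of_ne hxy]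
        exact hw x (by simp [hxy, hx])

theorem Formula.holds_exs {V : Finset (Var Sg)} {φ : Formula Sg} :
    (exs V φ).Holds M v ↔ ∃ w : (x : Var Sg) → M.dom x.1,
      (∀ x ∉ V, w x = v x) ∧ φ.Holds M w := by
  simp [exs, holds_foldr_ex]

/-- The disjunction of a list of formulas (`⊥` for the empty list). -/
def Formula.disj (l : List (Formula Sg)) : Formula Sg := l.foldr (fun φ ψ => imp φ.neg ψ) falsum

theorem Formula.holds_disj {l : List (Formula Sg)} :
    (disj l).Holds M v ↔ ∃ φ ∈ l, φ.Holds M v := by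
  induction l with
  | nil => simp [disj, Formula.Holds]
  | cons φ l ih =>
    have : disj (φ :: l) = imp φ.neg (disj l) := rfl
    simp only [this, Formula.Holds, holds_neg, ih, List.mem_cons, exists_eq_or_imp]
    tauto

end Connectives

@[simp] theorem Interp.sat_and {A : Interp Sg} {φ ψ : Formula Sg} :
    A.Sat (φ.and ψ) ↔ A.Sat φ ∧ A.Sat ψ := Formula.holds_and

theorem Interp.sat_disj {A : Interp Sg} {l : List (Formula Sg)} :
    A.Sat (Formula.disj l) ↔ ∃ φ ∈ l, A.Sat φ := Formula.holds_disj

theorem Interp.sat_exs {A : Interp Sg} {V : Finset (Var Sg)} {φ : Formula Sg} :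
    A.Sat (Formula.exs V φ) ↔ ∃ w : (x : Var Sg) → A.dom x.1,
      (∀ x ∉ V, w x = A.val x) ∧ (A.withVal w).Sat φ := Formula.holds_exs

@[simp] theorem Formula.vars_and {φ ψ : Formula Sg} : (φ.and ψ).vars = φ.vars ∪ ψ.vars := by
  simp [Formula.and, Formula.neg, Formula.vars]

theorem Formula.IsQF.and {φ ψ : Formula Sg} (hφ : φ.IsQF) (hψ : ψ.IsQF) : (φ.and ψ).IsQF :=
  ⟨⟨hφ, hψ, trivial⟩, trivial⟩

theorem Formula.mem_vars_conj {l : List (Formula Sg)} {x : Var Sg} :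
    x ∈ (conj l).vars ↔ ∃ φ ∈ l, x ∈ φ.vars := by
  induction l with
  | nil => simp [conj, verum, neg, vars]
  | cons φ l ih =>
    have : conj (φ :: l) = φ.and (conj l) := rfl
    simp [this, ih]

theorem Formula.isQF_conj {l : List (Formula Sg)} (h : ∀ φ ∈ l, φ.IsQF) : (conj l).IsQF := by
  induction l with
  | nil => exact ⟨trivial, trivial⟩
  | cons φ l ih =>
    exact (h φ (by simp)).and (ih fun ψ hψ => h ψ (by simp [hψ]))

theorem Formula.mem_vars_disj {l : List (Formula Sg)} {x : Var Sg} :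
    x ∈ (disj l).vars ↔ ∃ φ ∈ l, x ∈ φ.vars := by
  induction l with
  | nil => simp [disj, vars]
  | cons φ l ih =>
    have : disj (φ :: l) = imp φ.neg (disj l) := rfl
    simp [this, ih, vars, neg]

theorem Formula.isQF_disj {l : List (Formula Sg)} (h : ∀ φ ∈ l, φ.IsQF) : (disj l).IsQF := by
  induction l with
  | nil => trivial
  | cons φ l ih =>
    exact ⟨⟨h φ (by simp), trivial⟩, ih fun ψ hψ => h ψ (by simp [hψ])⟩

/-! ### Arrangements and equality patterns -/

/-- Quantifying over one sort and two indices, not over pairs of variables, lets both values live in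
the same domain without casts. -/
theorem Interp.sat_arrangement {A : Interp Sg} {V : Finset (Var Sg)} {E : Setoid V} :
    A.Sat (arrangement V E) ↔ ∀ (σ : Sg.Sorts) (m n : ℕ) (hm : (⟨σ, m⟩ : Var Sg) ∈ V)
      (hn : (⟨σ, n⟩ : Var Sg) ∈ V), (A.val ⟨σ, m⟩ = A.val ⟨σ, n⟩ ↔ E ⟨_, hm⟩ ⟨_, hn⟩) := by
  classical
  rw [arrangement, Interp.Sat, Formula.holds_conj]
  simp only [List.mem_map, Finset.mem_toList, Finset.mem_filter, Finset.mem_univ, true_and,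
    forall_exists_index, and_imp, forall_apply_eq_imp_iff₂]
  constructor
  · intro h σ m n hm hn
    have := h (⟨_, hm⟩, ⟨_, hn⟩) rfl
    dsimp only at this
    split_ifs at this with hE
    · exact iff_of_true this hE
    · exact iff_of_false this hE
  · rintro h ⟨⟨⟨σ, m⟩, hm⟩, ⟨⟨τ, n⟩, hn⟩⟩ hst
    dsimp only at hst
    subst hst
    have := h σ m n hm hn
    dsimp only
    split_ifs with hE
    · exact this.2 hE
    · exact fun h' => hE (this.1 h')

theorem vars_arrangement {V : Finset (Var Sg)} {E : Setoid V} : (arrangement V E).vars = V := by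
  classical
  ext x
  rw [arrangement, Formula.mem_vars_conj]
  simp only [List.mem_map, Finset.mem_toList, Finset.mem_filter, Finset.mem_univ, true_and]
  constructor
  · rintro ⟨_, ⟨⟨⟨⟨σ, m⟩, hm⟩, ⟨⟨τ, n⟩, hn⟩⟩, hst, rfl⟩, hx⟩
    dsimp only at hst hx
    subst hst
    split_ifs at hx <;>
    · simp only [Formula.neg, Formula.vars, Term.vars, Finset.mem_union, Finset.mem_singleton,
        Finset.notMem_empty, or_false] at hx
      rcases hx with rfl | rfl <;> assumption
  · intro hx
    refine ⟨_, ⟨(⟨x, hx⟩, ⟨x, hx⟩), rfl, rfl⟩, ?_⟩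
    dsimp only
    rw [if_pos (Setoid.refl _)]
    simp [Formula.vars, Term.vars]

theorem isQF_arrangement {V : Finset (Var Sg)} {E : Setoid V} : (arrangement V E).IsQF := by
  classical
  refine Formula.isQF_conj fun φ hφ => ?_
  obtain ⟨p, -, rfl⟩ := List.mem_map.1 hφ
  dsimp only
  split_ifs
  · trivial
  · exact ⟨trivial, trivial⟩

/-- `A` and `B` satisfy the same equations between variables in `V`. -/
def SamePattern (A B : Interp Sg) (V : Finset (Var Sg)) : Prop :=
  ∀ (σ : Sg.Sorts) (m n : ℕ), (⟨σ, m⟩ : Var Sg) ∈ V → (⟨σ, n⟩ : Var Sg) ∈ V →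
    (A.val ⟨σ, m⟩ = A.val ⟨σ, n⟩ ↔ B.val ⟨σ, m⟩ = B.val ⟨σ, n⟩)

theorem SamePattern.symm {A B : Interp Sg} {V : Finset (Var Sg)} (h : SamePattern A B V) :
    SamePattern B A V := fun σ m n hm hn => (h σ m n hm hn).symm

theorem SamePattern.sat_arrangement {A B : Interp Sg} {V W : Finset (Var Sg)} {E : Setoid V}
    (h : SamePattern A B W) (hVW : V ⊆ W) (hA : A.Sat (arrangement V E)) :
    B.Sat (arrangement V E) := by
  rw [Interp.sat_arrangement] at hA ⊢
  exact fun σ m n hm hn => (h σ m n (hVW hm) (hVW hn)).symm.trans (hA σ m n hm hn)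

theorem SamePattern.of_sat {A B : Interp Sg} {V : Finset (Var Sg)} {E : Setoid V}
    (hA : A.Sat (arrangement V E)) (hB : B.Sat (arrangement V E)) : SamePattern A B V := by
  rw [Interp.sat_arrangement] at hA hB
  exact fun σ m n hm hn => (hA σ m n hm hn).trans (hB σ m n hm hn).symm

/-- The equivalence relation of having the same value in `A`. -/
def Interp.ker (A : Interp Sg) (V : Finset (Var Sg)) : Setoid V :=
  Setoid.ker fun x => (⟨x.1.1, A.val x.1⟩ : Σ σ, A.dom σ)

theorem Interp.respectsSorts_ker (A : Interp Sg) (V : Finset (Var Sg)) :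
    RespectsSorts V (A.ker V) := fun x y h =>
  congrArg (fun p : Σ σ, A.dom σ => p.1)
    (show (⟨x.1.1, A.val x.1⟩ : Σ σ, A.dom σ) = ⟨y.1.1, A.val y.1⟩ from h)

theorem Interp.sat_arrangement_ker (A : Interp Sg) (V : Finset (Var Sg)) :
    A.Sat (arrangement V (A.ker V)) := by
  rw [Interp.sat_arrangement]
  intro σ m n hm hn
  rw [Interp.ker, Setoid.ker_def]
  simp

/-- The values in `A` of the variables of sort `σ` in `V`. -/
def Interp.vals (A : Interp Sg) (V : Finset (Var Sg)) (σ : Sg.Sorts) : Set (A.dom σ) :=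
  {a | ∃ n : ℕ, (⟨σ, n⟩ : Var Sg) ∈ V ∧ A.val ⟨σ, n⟩ = a}

theorem Interp.varValues_eq {A : Interp Sg} {φ : Formula Sg} {σ : Sg.Sorts} :
    A.varValues φ σ = A.vals φ.vars σ := rfl

theorem Interp.vals_mono {A : Interp Sg} {V W : Finset (Var Sg)} (h : V ⊆ W) (σ : Sg.Sorts) :
    A.vals V σ ⊆ A.vals W σ := fun _ ⟨n, hn, e⟩ => ⟨n, h hn, e⟩

theorem Interp.finite_vals (A : Interp Sg) (V : Finset (Var Sg)) (σ : Sg.Sorts) :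
    (A.vals V σ).Finite := by
  classical
  refine ((V.finite_toSet.preimage (f := fun n : ℕ => (⟨σ, n⟩ : Var Sg)) ?_).image
    fun n => A.val ⟨σ, n⟩).subset ?_
  · intro m _ n _ h
    simpa using h
  · rintro a ⟨n, hn, rfl⟩
    exact ⟨n, hn, rfl⟩

/-- Choosing a variable for each value in `A` and evaluating it in `B` is injective, because
equations transfer. -/
theorem SamePattern.mk_vals_le {A B : Interp Sg} {V : Finset (Var Sg)} (h : SamePattern A B V)
    (σ : Sg.Sorts) : Cardinal.mk (A.vals V σ) ≤ Cardinal.mk (B.vals V σ) := by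
  choose n hn hv using fun a : A.vals V σ => a.2
  refine Cardinal.mk_le_of_injective (f := fun a => ⟨B.val ⟨σ, n a⟩, n a, hn a, rfl⟩) ?_
  intro a b hab
  have := (h σ _ _ (hn a) (hn b)).2 (congrArg Subtype.val hab)
  rw [hv, hv] at this
  exact Subtype.ext this

theorem SamePattern.mk_vals_eq {A B : Interp Sg} {V : Finset (Var Sg)} (h : SamePattern A B V)
    (σ : Sg.Sorts) : Cardinal.mk (A.vals V σ) = Cardinal.mk (B.vals V σ) :=
  le_antisymm (h.mk_vals_le σ) (h.symm.mk_vals_le σ)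

/-- If `A` gives `x` the value of an old variable, the same variable is copied in `C`. Otherwise a
fresh value is needed; it exists because the old variables take equally many values in `A` and `C`,
and `hc` leaves room for one more. -/
theorem SamePattern.extend_insert {A C : Interp Sg} {V : Finset (Var Sg)} (h : SamePattern A C V)
    {x : Var Sg} (hx : x ∉ V)
    (hc : Cardinal.mk (A.vals (insert x V) x.1) ≤ Cardinal.mk (C.dom x.1)) :
    ∃ c, SamePattern A (C.withVal (Function.update C.val x c)) (insert x V) := by
  obtain ⟨τ, k⟩ := x
  -- it suffices to find a value that agrees with every old variable of the same sort
  suffices H : ∃ c : C.dom τ, ∀ n, (⟨τ, n⟩ : Var Sg) ∈ V →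
      (A.val ⟨τ, k⟩ = A.val ⟨τ, n⟩ ↔ c = C.val ⟨τ, n⟩) by
    obtain ⟨c, hcV⟩ := H
    refine ⟨c, fun σ m n hm hn => ?_⟩
    simp only [Interp.withVal]
    rw [Finset.mem_insert] at hm hn
    have key : ∀ n, (⟨τ, n⟩ : Var Sg) ∈ V → (⟨τ, n⟩ : Var Sg) ≠ ⟨τ, k⟩ :=
      fun n hn e => hx (e ▸ hn)
    rcases hm with hm | hm
    · cases hm
      rcases hn with hn | hn
      · cases hn; simp
      · rw [Function.update_self, Function.update_of_ne (key n hn)]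
        exact hcV n hn
    · rcases hn with hn | hn
      · cases hn
        rw [Function.update_self, Function.update_of_ne (key m hm), eq_comm,
          eq_comm (a := C.val _)]
        exact hcV m hm
      · rw [Function.update_of_ne (ne_of_mem_of_not_mem hm hx),
          Function.update_of_ne (ne_of_mem_of_not_mem hn hx)]
        exact h σ m n hm hn
  by_cases hv : A.val ⟨τ, k⟩ ∈ A.vals V τ
  · obtain ⟨l, hl, e⟩ := hv
    exact ⟨C.val ⟨τ, l⟩, fun n hn => by rw [← e]; exact h τ l n hl hn⟩
  · have hlt : Cardinal.mk (C.vals V τ) < Cardinal.mk (C.dom τ) := by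
      rw [← h.mk_vals_eq]
      refine lt_of_lt_of_le ?_ hc
      have hfin := (A.finite_vals (insert ⟨τ, k⟩ V) τ)
      have hss : A.vals V τ ⊂ A.vals (insert ⟨τ, k⟩ V) τ := by
        refine ⟨Interp.vals_mono (Finset.subset_insert _ _) τ, fun hsub => hv (hsub ?_)⟩
        exact ⟨k, Finset.mem_insert_self _ _, rfl⟩
      have := Set.ncard_lt_ncard hss hfin
      rw [← Set.cast_ncard hfin, ← Set.cast_ncard (A.finite_vals V τ)]
      exact_mod_cast this
    have : ∃ c, c ∉ C.vals V τ := by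
      by_contra! hall
      have : C.vals V τ = Set.univ := Set.eq_univ_of_forall hall
      rw [this, Cardinal.mk_univ] at hlt
      exact lt_irrefl _ hlt
    obtain ⟨c, hcn⟩ := this
    exact ⟨c, fun n hn => iff_of_false (fun e => hv ⟨n, hn, e.symm⟩) fun e => hcn ⟨n, hn, e.symm⟩⟩

/-- The sets may overlap. Only variables in `D` outside `V` are reassigned, so formulas without such
variables keep their truth value. -/
theorem SamePattern.extend {A C : Interp Sg} {V : Finset (Var Sg)} (h : SamePattern A C V)
    (D : Finset (Var Sg))
    (hc : ∀ x ∈ D, Cardinal.mk (A.vals (V ∪ D) x.1) ≤ Cardinal.mk (C.dom x.1)) :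
    ∃ v : (x : Var Sg) → C.dom x.1, (∀ x, x ∈ V ∨ x ∉ D → v x = C.val x) ∧
      SamePattern A (C.withVal v) (V ∪ D) := by
  induction D using Finset.induction_on with
  | empty => exact ⟨C.val, fun _ _ => rfl, by rwa [Finset.union_empty]⟩
  | insert x D hx ih =>
    have hsub : V ∪ D ⊆ V ∪ insert x D :=
      Finset.union_subset_union_right (Finset.subset_insert _ _)
    obtain ⟨v, hv, hp⟩ := ih fun y hy =>
      (Cardinal.mk_le_mk_of_subset (Interp.vals_mono hsub _)).trans
        (hc y (Finset.mem_insert_of_mem hy))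
    by_cases hxV : x ∈ V ∪ D
    · refine ⟨v, fun y hy => hv y (hy.imp_right fun h' => fun h'' =>
        h' (Finset.mem_insert_of_mem h'')), ?_⟩
      rwa [Finset.union_insert, Finset.insert_eq_of_mem hxV]
    · obtain ⟨c, hcp⟩ : ∃ c : C.dom x.1,
          SamePattern A (C.withVal (Function.update v x c)) (insert x (V ∪ D)) :=
        hp.extend_insert hxV (by
          rw [← Finset.union_insert]; exact hc x (Finset.mem_insert_self _ _))
      refine ⟨Function.update v x c, fun y hy => ?_, ?_⟩
      · rw [Function.update_of_ne, hv y (hy.imp_right fun h' h'' =>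
          h' (Finset.mem_insert_of_mem h''))]
        rintro rfl
        rcases hy with hy | hy
        · exact hxV (Finset.mem_union_left _ hy)
        · exact hy (Finset.mem_insert_self _ _)
      · rw [Finset.union_insert]
        exact hcp

/-- `K` variables of every sort in `S`, with indices from `M` on. -/
noncomputable def block (S : Finset Sg.Sorts) (M K : ℕ) : Finset (Var Sg) :=
  S.sigma fun _ => Finset.Ico M (M + K)

theorem mem_block {S : Finset Sg.Sorts} {M K : ℕ} {x : Var Sg} :
    x ∈ block S M K ↔ x.1 ∈ S ∧ M ≤ x.2 ∧ x.2 < M + K := by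
  simp [block]

theorem exists_bound_index (V : Finset (Var Sg)) : ∃ M, ∀ x ∈ V, x.2 < M :=
  ⟨V.sup (fun x => x.2) + 1, fun _ hx => Nat.lt_succ_of_le (Finset.le_sup (f := fun x => x.2) hx)⟩

/-- Assign the variables of a block so that together with the variables in `V` they take exactly
the values in prescribed finite sets. -/
theorem Interp.exists_fill (A : Interp Sg) {V : Finset (Var Sg)} {S : Finset Sg.Sorts} {M K : ℕ}
    (Y : (σ : Sg.Sorts) → Set (A.dom σ))
    (hY : ∀ σ ∈ S, (Y σ).Finite ∧ (Y σ).Nonempty ∧ (Y σ).ncard ≤ K ∧ A.vals V σ ⊆ Y σ) :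
    ∃ v : (x : Var Sg) → A.dom x.1, (∀ x ∉ block S M K, v x = A.val x) ∧
      ∀ σ ∈ S, (A.withVal v).vals (V ∪ block S M K) σ = Y σ := by
  classical
  have henum : ∀ σ ∈ S, ∃ f : ℕ → A.dom σ, f '' Set.Iio K = Y σ := by
    intro σ hσ
    obtain ⟨hf, ⟨y, hy⟩, hK, -⟩ := hY σ hσ
    have := hf.fintype
    let e := Fintype.equivFin (Y σ)
    have hcard : Fintype.card (Y σ) = (Y σ).ncard := by
      rw [Set.ncard_eq_toFinset_card', Set.toFinset_card]
    -- Indices past the last element repeat `y`, so any `K` that is at least the size of `Y σ` will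
    -- do.
    refine ⟨fun k => if h : k < Fintype.card (Y σ) then (e.symm ⟨k, h⟩ : A.dom σ) else y, ?_⟩
    ext a
    simp only [Set.mem_image, Set.mem_Iio]
    constructor
    · rintro ⟨k, -, rfl⟩
      split_ifs
      · exact Subtype.prop _
      · exact hy
    · intro ha
      refine ⟨e ⟨a, ha⟩, lt_of_lt_of_le (e ⟨a, ha⟩).2 (hcard.trans_le hK), ?_⟩
      rw [dif_pos (e ⟨a, ha⟩).2]
      simp
  have := A.dom_nonempty
  choose! f hf using henum
  let v : (x : Var Sg) → A.dom x.1 := fun x =>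
    if x ∈ block S M K then f x.1 (x.2 - M) else A.val x
  refine ⟨v, fun x hx => if_neg hx, fun σ hσ => ?_⟩
  ext a
  constructor
  · rintro ⟨n, hn, rfl⟩
    change v ⟨σ, n⟩ ∈ Y σ
    by_cases hb : (⟨σ, n⟩ : Var Sg) ∈ block S M K
    · simp only [v, if_pos hb]
      rw [← hf σ hσ]
      have := mem_block.1 hb
      exact ⟨n - M, by simp only [Set.mem_Iio]; simp only at this; omega, rfl⟩
    · simp only [v, if_neg hb]
      exact (hY σ hσ).2.2.2 ⟨n, (Finset.mem_union.1 hn).resolve_right hb, rfl⟩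
  · intro ha
    rw [← hf σ hσ] at ha
    obtain ⟨k, hk, rfl⟩ := ha
    rw [Set.mem_Iio] at hk
    have hb : (⟨σ, M + k⟩ : Var Sg) ∈ block S M K :=
      mem_block.2 ⟨hσ, by simp, by simpa using hk⟩
    refine ⟨M + k, Finset.mem_union_right _ hb, ?_⟩
    change v ⟨σ, M + k⟩ = _
    simp only [v, if_pos hb, Nat.add_sub_cancel_left]

/-! ### Consequences of having a strong pre-witness -/

/-- The variables of `φ` with sorts in `S`. -/
noncomputable def Formula.varsIn (φ : Formula Sg) (S : Set Sg.Sorts) : Finset (Var Sg) :=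
  open Classical in φ.vars.filter fun x => x.1 ∈ S

theorem Formula.mem_varsIn {φ : Formula Sg} {S : Set Sg.Sorts} {x : Var Sg} :
    x ∈ φ.varsIn S ↔ x ∈ φ.vars ∧ x.1 ∈ S := by
  classical
  simp [Formula.varsIn]

theorem Interp.vals_congr {A : Interp Sg} {V W : Finset (Var Sg)} {σ : Sg.Sorts}
    (h : ∀ n, (⟨σ, n⟩ : Var Sg) ∈ V ↔ (⟨σ, n⟩ : Var Sg) ∈ W) : A.vals V σ = A.vals W σ := by
  simp [Interp.vals, h]

namespace Theory

variable {T : Theory Sg} {S : Set Sg.Sorts}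

theorem IsPreWitness.sat_of_sat {wit : QF Sg → QF Sg} (h : T.IsPreWitness S wit) {φ : QF Sg}
    {A : Interp Sg} (hA : T.Models A) (hs : A.Sat (wit φ).1) : A.Sat φ.1 :=
  ((h φ).1 A hA).2 (Interp.sat_exs.2 ⟨A.val, fun _ _ => rfl, hs⟩)

theorem IsPreWitness.exists_sat {wit : QF Sg → QF Sg} (h : T.IsPreWitness S wit) {φ : QF Sg}
    {A : Interp Sg} (hA : T.Models A) (hs : A.Sat φ.1) :
    ∃ v, (A.withVal v).Sat (wit φ).1 := by
  obtain ⟨v, -, hv⟩ := Interp.sat_exs.1 (((h φ).1 A hA).1 hs)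
  exact ⟨v, hv⟩

/-- From a model of a witness and a finite set of variables containing those of the witness one
gets a model covered by these variables. -/
theorem IsStrongPreWitness.exists_covered {wit : QF Sg → QF Sg} (h : T.IsStrongPreWitness S wit)
    {φ : QF Sg} {A : Interp Sg} (hA : T.Models A) (hs : A.Sat (wit φ).1) {V : Finset (Var Sg)}
    (hV : ∀ x ∈ V, x.1 ∈ S) (hsub : (wit φ).1.varsIn S ⊆ V) :
    ∃ B, T.Models B ∧ B.Sat φ.1 ∧
      ∀ σ ∈ S, Cardinal.mk (B.dom σ) = Cardinal.mk (A.vals V σ) := by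
  have hsat : A.Sat ((wit φ).1.and (arrangement V (A.ker V))) :=
    Interp.sat_and.2 ⟨hs, A.sat_arrangement_ker V⟩
  obtain ⟨B, hB, hBs, hcov⟩ := h.2 φ V hV _ (A.respectsSorts_ker V) ⟨A, hA, hsat⟩
  rw [Interp.sat_and] at hBs
  refine ⟨B, hB, h.1.sat_of_sat hB hBs.1, fun σ hσ => ?_⟩
  have hp : SamePattern A B V := SamePattern.of_sat (A.sat_arrangement_ker V) hBs.2
  rw [hp.mk_vals_eq, ← Cardinal.mk_univ, ← hcov σ hσ, Interp.varValues_eq, Formula.vars_and,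
    vars_arrangement]
  rw [Interp.vals_congr]
  intro n
  simp only [Finset.mem_union, or_iff_right_iff_imp]
  exact fun hn => hsub (Formula.mem_varsIn.2 ⟨hn, hσ⟩)

/-- A model covered by the variables of the witness, in the arrangement that `A` induces, has as
many elements as these variables have values in `A`. -/
theorem HasStrongPreWitness.stablyFinite (h : T.HasStrongPreWitness S) : T.StablyFinite S := by
  obtain ⟨wit, h⟩ := h
  intro φ hφ A hA hs
  obtain ⟨v, hv⟩ := h.1.exists_sat (φ := ⟨φ, hφ⟩) hA hs
  obtain ⟨B, hB, hBs, hcard⟩ := h.exists_covered (hA.withVal v) hv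
    (V := (wit ⟨φ, hφ⟩).1.varsIn S) (fun x hx => (Formula.mem_varsIn.1 hx).2) subset_rfl
  refine ⟨B, hB, hBs, fun σ hσ => ⟨?_, ?_⟩⟩
  · rw [hcard σ hσ, Cardinal.lt_aleph0_iff_set_finite]
    exact Interp.finite_vals _ _ _
  · rw [hcard σ hσ]
    exact Cardinal.mk_set_le _

/-- Stable infiniteness provides room: in an infinite model with the same arrangement, spare
variables can be given values until exactly `κ σ` values are taken. Clause (c) then cuts the model
down to these values. -/
theorem HasStrongPreWitness.finitelySmooth (h : T.HasStrongPreWitness S) (hS : S.Finite)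
    (hinf : T.StablyInfinite S) : T.FinitelySmooth S := by
  classical
  obtain ⟨wit, h⟩ := h
  intro φ hφ A hA hs κ hκ hfin
  obtain ⟨v, hv⟩ := h.1.exists_sat (φ := ⟨φ, hφ⟩) hA hs
  set ψ := (wit ⟨φ, hφ⟩).1 with hψ
  set V := ψ.varsIn S
  -- an infinite model of the witness with the same pattern
  obtain ⟨C, hC, hCs, hCinf⟩ := hinf (ψ.and (arrangement V ((A.withVal v).ker V)))
    ((wit ⟨φ, hφ⟩).2.and isQF_arrangement)
    ⟨A.withVal v, hA.withVal v, Interp.sat_and.2 ⟨hv, Interp.sat_arrangement_ker _ V⟩⟩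
  rw [Interp.sat_and] at hCs
  have hp : SamePattern (A.withVal v) C V :=
    SamePattern.of_sat (Interp.sat_arrangement_ker _ V) hCs.2
  -- sets of the prescribed finite cardinalities
  have hY : ∀ σ (hσ : σ ∈ S), ∃ Y : Set (C.dom σ), C.vals V σ ⊆ Y ∧ Y.Finite ∧ Y.Nonempty ∧
      Cardinal.mk Y = κ ⟨σ, hσ⟩ := by
    intro σ hσ
    obtain ⟨k, hk⟩ := Cardinal.lt_aleph0.1 (hfin ⟨σ, hσ⟩)
    have hle : Cardinal.mk (C.vals V σ) ≤ k := by
      rw [← hp.mk_vals_eq, ← hk]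
      exact (Cardinal.mk_set_le _).trans (hκ ⟨σ, hσ⟩)
    have : Infinite (C.dom σ) := Cardinal.infinite_iff.2 (hCinf σ hσ)
    have hfv := C.finite_vals V σ
    obtain ⟨Y, hYs, hYc⟩ := Infinite.exists_superset_card_eq hfv.toFinset k (by
      rw [← Set.cast_ncard hfv, Set.ncard_eq_toFinset_card _ hfv] at hle
      exact_mod_cast hle)
    have hc : Cardinal.mk (Y : Set (C.dom σ)) = κ ⟨σ, hσ⟩ := by
      rw [hk, ← hYc]; exact Cardinal.mk_coe_finset
    refine ⟨Y, fun a ha => hYs (hfv.mem_toFinset.2 ha), Y.finite_toSet, ?_, hc⟩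
    rw [← Set.nonempty_coe_sort, ← Cardinal.mk_ne_zero_iff, hc]
    have := A.dom_nonempty σ
    exact (lt_of_lt_of_le (Cardinal.mk_ne_zero (A.dom σ)).bot_lt (hκ ⟨σ, hσ⟩)).ne'
  choose! Y hYV hYf hYn hYc using hY
  -- The spare variables start beyond all indices in the witness, so reassigning them preserves its
  -- truth.
  obtain ⟨M, hM⟩ := exists_bound_index ψ.vars
  let F := hS.toFinset
  let K := F.sup fun σ => (Y σ).ncard
  obtain ⟨w, hw, hwY⟩ := C.exists_fill (V := V) (S := F) (M := M) (K := K)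
    Y fun σ hσ => by
      have hσ' := hS.mem_toFinset.1 hσ
      exact ⟨hYf σ hσ', hYn σ hσ', Finset.le_sup (f := fun σ => (Y σ).ncard) hσ, hYV σ hσ'⟩
  have hws : (C.withVal w).Sat ψ := (Interp.sat_withVal_iff fun x hx => hw x fun hb => by
    have := (mem_block.1 hb).2.1
    have := hM x hx
    omega).2 hCs.1
  obtain ⟨B, hB, hBs, hcard⟩ := h.exists_covered (hC.withVal w) hws (V := V ∪ block F M K)
    (fun x hx => by
      rcases Finset.mem_union.1 hx with hx | hx
      · exact (Formula.mem_varsIn.1 hx).2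
      · exact hS.mem_toFinset.1 (mem_block.1 hx).1) Finset.subset_union_left
  refine ⟨B, hB, hBs, fun σ => ?_⟩
  rw [hcard σ σ.2, hwY σ (hS.mem_toFinset.2 σ.2)]
  exact hYc σ σ.2

end Theory

/-! ### Construction of a strong pre-witness -/

/-- Dickson's lemma: every set of tuples of natural numbers has bounded elements below all its
elements. -/
theorem exists_bound_minimal {ι : Type*} [Finite ι] (N : Set (ι → ℕ)) :
    ∃ K : ℕ, ∀ n ∈ N, ∃ m ∈ N, m ≤ n ∧ ∀ i, m i ≤ K := by
  have hpwo : N.IsPWO := Set.isPWO_of_wellQuasiOrderedLE N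
  have hfin : {m | Minimal (· ∈ N) m}.Finite :=
    WellQuasiOrderedLE.finite_of_isAntichain (setOfPred_minimal_antichain (· ∈ N))
  have := Fintype.ofFinite ι
  refine ⟨hfin.toFinset.sup fun m => Finset.univ.sup m, fun n hn => ?_⟩
  obtain ⟨m, hmn, hm⟩ := hpwo.exists_le_minimal hn
  refine ⟨m, hm.1, hmn, fun i => ?_⟩
  exact (Finset.le_sup (f := m) (Finset.mem_univ i)).trans
    (Finset.le_sup (f := fun m => Finset.univ.sup m) (hfin.mem_toFinset.2 hm))

instance (V : Finset (Var Sg)) : Finite (Setoid V) :=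
  Finite.of_injective (fun E : Setoid V => fun x y => E x y) fun E E' h => by
    ext x y
    exact iff_of_eq (congrFun (congrFun h x) y)

namespace Theory

variable {T : Theory Sg} {S : Set Sg.Sorts}

/-- All models of `φ` can be shrunk to models of uniformly bounded finite size. -/
theorem StablyFinite.exists_bound (h : T.StablyFinite S) (hS : S.Finite) {φ : Formula Sg}
    (hφ : φ.IsQF) (V : Finset (Var Sg)) :
    ∃ K : ℕ, ∀ A, T.Models A → A.Sat φ → ∃ B, T.Models B ∧ B.Sat φ ∧ SamePattern B A V ∧
      ∀ σ ∈ S, Cardinal.mk (B.dom σ) ≤ Cardinal.mk (A.dom σ) ∧ Cardinal.mk (B.dom σ) ≤ K := by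
  have := hS.to_subtype
  -- Dickson's lemma is applied separately to each of the finitely many arrangements of `V`, so that
  -- the small model also has the right pattern.
  choose K hK using fun E : Setoid V => exists_bound_minimal
    {n : S → ℕ | ∃ A, T.Models A ∧ A.Sat (φ.and (arrangement V E)) ∧
      ∀ σ : S, Cardinal.mk (A.dom σ) = n σ}
  have := Fintype.ofFinite (Setoid V)
  refine ⟨Finset.univ.sup K, fun A hA hs => ?_⟩
  have hsat : A.Sat (φ.and (arrangement V (A.ker V))) :=
    Interp.sat_and.2 ⟨hs, A.sat_arrangement_ker V⟩
  obtain ⟨B, hB, hBs, hBc⟩ := h _ (hφ.and isQF_arrangement) A hA hsat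
  have hn : ∀ σ : S, ∃ n : ℕ, Cardinal.mk (B.dom σ) = n := fun σ =>
    Cardinal.lt_aleph0.1 (hBc σ σ.2).1
  choose n hn using hn
  obtain ⟨m, ⟨C, hC, hCs, hCc⟩, hmn, hmK⟩ := hK (A.ker V) n ⟨B, hB, hBs, hn⟩
  rw [Interp.sat_and] at hCs
  refine ⟨C, hC, hCs.1, SamePattern.of_sat hCs.2 (A.sat_arrangement_ker V), fun σ hσ => ?_⟩
  have e := hCc ⟨σ, hσ⟩
  dsimp only at e
  rw [e]
  constructor
  · refine le_trans ?_ (hBc σ hσ).2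
    have e' := hn ⟨σ, hσ⟩
    dsimp only at e'
    rw [e']
    exact_mod_cast hmn ⟨σ, hσ⟩
  · exact_mod_cast (hmK ⟨σ, hσ⟩).trans (Finset.le_sup (Finset.mem_univ _))

/-- `φ` and the arrangement have a model covered by the variables in `X`. -/
def CoverableArrangement (T : Theory Sg) (S : Set Sg.Sorts) (φ : Formula Sg) (X : Finset (Var Sg))
    (D : Setoid X) : Prop :=
  ∃ B, T.Models B ∧ B.Sat φ ∧ B.Sat (arrangement X D) ∧ ∀ σ ∈ S, B.vals X σ = Set.univ

open Classical in
/-- `φ` together with the disjunction of the arrangements of `X` that have a covered model. -/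
noncomputable def coverFormula (T : Theory Sg) (S : Set Sg.Sorts) (φ : Formula Sg)
    (X : Finset (Var Sg)) : Formula Sg :=
  φ.and <| Formula.disj <|
    (Set.toFinite {D : Setoid X | T.CoverableArrangement S φ X D}).toFinset.toList.map
      fun D => arrangement X D

theorem sat_coverFormula {φ : Formula Sg} {X : Finset (Var Sg)} {A : Interp Sg} :
    A.Sat (T.coverFormula S φ X) ↔
      A.Sat φ ∧ ∃ D, T.CoverableArrangement S φ X D ∧ A.Sat (arrangement X D) := by
  simp [coverFormula, Interp.sat_and, Interp.sat_disj]

theorem isQF_coverFormula {φ : Formula Sg} (hφ : φ.IsQF) (X : Finset (Var Sg)) :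
    (T.coverFormula S φ X).IsQF := by
  refine hφ.and (Formula.isQF_disj fun ψ hψ => ?_)
  obtain ⟨D, -, rfl⟩ := List.mem_map.1 hψ
  exact isQF_arrangement

/-- A coverable arrangement is required because the empty disjunction contains no variables. -/
theorem subset_vars_coverFormula {φ : Formula Sg} {X : Finset (Var Sg)} {D : Setoid X}
    (hD : T.CoverableArrangement S φ X D) : X ⊆ (T.coverFormula S φ X).vars := by
  intro x hx
  simp only [coverFormula, Formula.vars_and, Finset.mem_union, Formula.mem_vars_disj]
  refine Or.inr ⟨arrangement X D, ?_, by rwa [vars_arrangement]⟩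
  simpa using ⟨D, hD, rfl⟩

/-- The disjunct `D` true in `A` has a model `B` covered by `X`. Enlarging `B` to the number of
values that `A` gives to `X ∪ V` leaves just enough elements to copy the whole pattern of `A`, and
these values then exhaust the domain. -/
theorem coverFormula_strong {φ : Formula Sg} (hφ : φ.IsQF) (h : T.FinitelySmooth S)
    {X : Finset (Var Sg)} (hX : φ.varsIn S ⊆ X) {V : Finset (Var Sg)} (hV : ∀ x ∈ V, x.1 ∈ S)
    {E : Setoid V} (hsat : T.Satisfiable ((T.coverFormula S φ X).and (arrangement V E))) :
    ∃ A, T.Models A ∧ A.Sat ((T.coverFormula S φ X).and (arrangement V E)) ∧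
      ∀ σ ∈ S, A.varValues ((T.coverFormula S φ X).and (arrangement V E)) σ = Set.univ := by
  obtain ⟨A, hA, hs⟩ := hsat
  rw [Interp.sat_and, sat_coverFormula] at hs
  obtain ⟨⟨hsφ, D, hD, hsD⟩, hsE⟩ := hs
  obtain ⟨B, hB, hBφ, hBD, hcov⟩ := id hD
  have hp : SamePattern A B X := SamePattern.of_sat hsD hBD
  obtain ⟨C, hC, hCs, hCc⟩ := h (φ.and (arrangement X D)) (hφ.and isQF_arrangement) B hB
    (Interp.sat_and.2 ⟨hBφ, hBD⟩) (fun σ => Cardinal.mk (A.vals (X ∪ V) σ))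
    (fun σ => by
      rw [← Cardinal.mk_univ, ← hcov σ σ.2, ← hp.mk_vals_eq]
      exact Cardinal.mk_le_mk_of_subset (Interp.vals_mono Finset.subset_union_left _))
    (fun σ => Cardinal.lt_aleph0_iff_set_finite.2 (A.finite_vals _ _))
  rw [Interp.sat_and] at hCs
  obtain ⟨v, hv, hvp⟩ := (SamePattern.of_sat hsD hCs.2).extend V
    (fun x hx => (hCc ⟨x.1, hV x hx⟩).ge)
  have hsat : (C.withVal v).Sat (T.coverFormula S φ X) := sat_coverFormula.2
    ⟨(Interp.sat_withVal_iff fun x hx => hv x <| by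
      by_cases hxV : x ∈ V
      · exact Or.inl (hX (Formula.mem_varsIn.2 ⟨hx, hV x hxV⟩))
      · exact Or.inr hxV).2 hCs.1, D, hD, hvp.sat_arrangement Finset.subset_union_left hsD⟩
  refine ⟨C.withVal v, hC.withVal v, Interp.sat_and.2
    ⟨hsat, hvp.sat_arrangement Finset.subset_union_right hsE⟩, fun σ hσ => ?_⟩
  have hsub : X ∪ V ⊆ ((T.coverFormula S φ X).and (arrangement V E)).vars := by
    rw [Formula.vars_and, vars_arrangement]
    exact Finset.union_subset_union_left (subset_vars_coverFormula hD)
  have hfin : (Set.univ : Set ((C.withVal v).dom σ)).Finite := by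
    rw [← Cardinal.lt_aleph0_iff_set_finite, Cardinal.mk_univ]
    exact (hCc ⟨σ, hσ⟩).trans_lt (Cardinal.lt_aleph0_iff_set_finite.2 (A.finite_vals _ _))
  -- Finiteness is essential: a subset with as many elements as the finite domain is all of it.
  have hall : (C.withVal v).vals (X ∪ V) σ = Set.univ := by
    refine Set.eq_of_subset_of_ncard_le (Set.subset_univ _) ?_ hfin
    have e : Cardinal.mk (Set.univ : Set ((C.withVal v).dom σ)) =
        Cardinal.mk ((C.withVal v).vals (X ∪ V) σ) := by
      rw [Cardinal.mk_univ, ← hvp.mk_vals_eq]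
      exact hCc ⟨σ, hσ⟩
    exact (congrArg Cardinal.toNat e).le
  exact Set.eq_univ_of_univ_subset (hall ▸ Interp.vals_mono hsub σ)

/-- With `K` fresh variables per sort, the small model `B` below a model `A` of `φ` is covered.
Since `A` is at least as large and agrees with `B` on the old variables, it can copy the arrangement
of the fresh ones. -/
theorem StablyFinite.exists_wit (h : T.StablyFinite S) (hS : S.Finite) (φ : QF Sg) : ∃ X : Finset (Var Sg), φ.1.varsIn S ⊆ X ∧
      T.Equivalent φ.1
        (Formula.exs ((T.coverFormula S φ.1 X).vars \ φ.1.vars) (T.coverFormula S φ.1 X)) := by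
  obtain ⟨K, hK⟩ := h.exists_bound hS φ.2 (φ.1.varsIn S)
  obtain ⟨M, hM⟩ := exists_bound_index φ.1.vars
  set V := φ.1.varsIn S with hV
  let F := hS.toFinset
  refine ⟨V ∪ block F M K, Finset.subset_union_left, fun A hA => ?_⟩
  rw [Interp.sat_exs]
  have hMb : ∀ x ∈ φ.1.vars, x ∉ block F M K := fun x hx hb => by
    have := (mem_block.1 hb).2.1
    have := hM x hx
    omega
  constructor
  · intro hs
    obtain ⟨B, hB, hBs, hp, hBc⟩ := hK A hA hs
    obtain ⟨v, hv, hvY⟩ := B.exists_fill (V := V) (S := F) (M := M) (K := K)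
      (fun σ => Set.univ) fun σ hσ => by
        have hle := (hBc σ (hS.mem_toFinset.1 hσ)).2
        have hfin : (Set.univ : Set (B.dom σ)).Finite := by
          rw [← Cardinal.lt_aleph0_iff_set_finite, Cardinal.mk_univ]
          exact hle.trans_lt (Cardinal.natCast_lt_aleph0)
        have := B.dom_nonempty σ
        refine ⟨hfin, Set.univ_nonempty, ?_, Set.subset_univ _⟩
        rw [← Cardinal.mk_univ, ← Set.cast_ncard hfin] at hle
        exact_mod_cast hle
    have hpv : SamePattern (B.withVal v) A V := by
      intro σ m n hm hn
      rw [← hp σ m n hm hn]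
      change v ⟨σ, m⟩ = v ⟨σ, n⟩ ↔ _
      rw [hv _ (hMb _ (Formula.mem_varsIn.1 hm).1), hv _ (hMb _ (Formula.mem_varsIn.1 hn).1)]
    obtain ⟨w, hw, hwp⟩ := hpv.extend (block F M K) fun x hx => by
      rw [hvY x.1 (mem_block.1 hx).1, Cardinal.mk_univ]
      exact (hBc x.1 (hS.mem_toFinset.1 (mem_block.1 hx).1)).1
    have hD : T.CoverableArrangement S φ.1 (V ∪ block F M K)
        ((B.withVal v).ker (V ∪ block F M K)) :=
      ⟨B.withVal v, hB.withVal v, (Interp.sat_withVal_iff fun x hx => hv x (hMb x hx)).2 hBs,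
        Interp.sat_arrangement_ker _ _, fun σ hσ => hvY σ (hS.mem_toFinset.2 hσ)⟩
    refine ⟨w, fun x hx => ?_, sat_coverFormula.2
      ⟨(Interp.sat_withVal_iff fun x hx => hw x (Or.inr (hMb x hx))).2 hs, _, hD,
        hwp.sat_arrangement subset_rfl (Interp.sat_arrangement_ker _ _)⟩⟩
    refine hw x ?_
    by_contra! hx'
    refine hx (Finset.mem_sdiff.2 ⟨?_, fun h' => hMb x h' hx'.2⟩)
    exact subset_vars_coverFormula hD (Finset.mem_union_right _ hx'.2)
  · rintro ⟨w, hw, hs⟩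
    refine (Interp.sat_withVal_iff fun x hx => hw x ?_).1 (sat_coverFormula.1 hs).1
    simp [hx]

theorem StablyFinite.hasStrongPreWitness (h : T.StablyFinite S) (hfs : T.FinitelySmooth S)
    (hS : S.Finite) : T.HasStrongPreWitness S := by
  choose X hX he using h.exists_wit hS
  refine ⟨fun φ => ⟨T.coverFormula S φ.1 (X φ), isQF_coverFormula φ.2 _⟩,
    fun φ => ⟨he φ, ?_⟩, fun φ V hV E _ hsat => coverFormula_strong φ.2 hfs (hX φ) hV hsat⟩
  rintro ⟨A, -, hs⟩
  obtain ⟨-, D, hD, -⟩ := sat_coverFormula.1 hs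
  obtain ⟨B, hB, hBs, -, hcov⟩ := id hD
  refine ⟨B, hB, hBs, fun σ hσ => Set.eq_univ_of_univ_subset ?_⟩
  rw [← hcov σ hσ]
  exact Interp.vals_mono (subset_vars_coverFormula hD) σ

end Theory

/-! ### Skolem terms and their values -/

/-- Terms over generators `G`, built with the variables, the function symbols and Skolem functions:
`skolem φ x args` denotes a counterexample `x` to `φ` for the values `args` of the other free
variables. -/
inductive SkolemTerm (Sg : Signature.{u}) (G : Sg.Sorts → Type u) : Sg.Sorts → Type u
  | gen {σ : Sg.Sorts} (g : G σ) : SkolemTerm Sg G σ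
  | var (x : Var Sg) : SkolemTerm Sg G x.1
  | app (f : Sg.Funcs) (args : (i : Fin (Sg.funArity f)) → SkolemTerm Sg G (Sg.funDom f i)) :
      SkolemTerm Sg G (Sg.funCod f)
  | skolem (φ : Formula Sg) (x : Var Sg) (args : (y : φ.vars) → SkolemTerm Sg G y.1.1) :
      SkolemTerm Sg G x.1

namespace SkolemTerm

variable {G H : Sg.Sorts → Type u}

open Classical in
/-- A counterexample `x` to `φ` if there is one. -/
noncomputable def counterexample (A : Interp Sg) (φ : Formula Sg) (x : Var Sg)
    (v : (y : φ.vars) → A.dom y.1.1) : A.dom x.1 :=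
  let v' : (y : Var Sg) → A.dom y.1 := fun y => if h : y ∈ φ.vars then v ⟨y, h⟩ else A.val y
  if h : ∃ a, ¬ φ.Holds A.toStruct (Function.update v' x a) then h.choose else A.val x

/-- The truth of `φ` depends only on its free variables, so the default values used outside them in
`counterexample` do no harm. -/
theorem not_holds_counterexample {A : Interp Sg} {φ : Formula Sg} {x : Var Sg}
    {v : (y : Var Sg) → A.dom y.1} (h : ¬ ∀ a, φ.Holds A.toStruct (Function.update v x a)) :
    ¬ φ.Holds A.toStruct (Function.update v x (counterexample A φ x fun y => v y)) := by
  classical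
  have hcongr : ∀ a, φ.Holds A.toStruct (Function.update v x a) ↔ φ.Holds A.toStruct
      (Function.update (fun y => if y ∈ φ.vars then v y else A.val y) x a) := by
    intro a
    refine φ.holds_congr fun y hy => ?_
    by_cases hyx : y = x
    · subst hyx; simp
    · simp [Function.update_of_ne hyx, hy]
  have h' : ∃ a, ¬ φ.Holds A.toStruct
      (Function.update (fun y => if y ∈ φ.vars then v y else A.val y) x a) := by
    simpa only [hcongr, not_forall] using h
  have e : counterexample A φ x (fun y => v y) = h'.choose := dif_pos h'
  rw [e, hcongr]
  exact h'.choose_spec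

/-- The value of a Skolem term in an interpretation. -/
noncomputable def eval (A : Interp Sg) (a : ∀ σ, G σ → A.dom σ) :
    {σ : Sg.Sorts} → SkolemTerm Sg G σ → A.dom σ
  | _, gen g => a _ g
  | _, var x => A.val x
  | _, app f args => A.func f fun i => (args i).eval A a
  | _, skolem φ x args => counterexample A φ x fun y => (args y).eval A a

/-- Change of generators. -/
def map (ρ : ∀ σ, H σ → G σ) : {σ : Sg.Sorts} → SkolemTerm Sg H σ → SkolemTerm Sg G σ
  | _, gen g => gen (ρ _ g)
  | _, var x => var x
  | _, app f args => app f fun i => (args i).map ρ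
  | _, skolem φ x args => skolem φ x fun y => (args y).map ρ

theorem eval_map (A : Interp Sg) (a : ∀ σ, G σ → A.dom σ) (ρ : ∀ σ, H σ → G σ) {σ : Sg.Sorts}
    (e : SkolemTerm Sg H σ) : (e.map ρ).eval A a = e.eval A fun σ h => a σ (ρ σ h) := by
  induction e with
  | gen g => rfl
  | var x => rfl
  | app f args ih =>
    simp only [map, eval]
    exact congrArg _ (funext ih)
  | skolem φ x args ih =>
    simp only [map, eval]
    exact congrArg _ (funext ih)

end SkolemTerm

/-! ### The Skolem hull of the generators in an ultraproduct -/

section Hull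

variable {ι : Type w} (U : Ultrafilter ι) (A : ι → Interp Sg) {G : Sg.Sorts → Type u}
  (a : ∀ i σ, G σ → (A i).dom σ)

/-- Skolem terms are identified if they are equal almost everywhere. -/
def hullSetoid (σ : Sg.Sorts) : Setoid (SkolemTerm Sg G σ) where
  r e e' := ∀ᶠ i in U, e.eval (A i) (a i) = e'.eval (A i) (a i)
  iseqv :=
    ⟨fun _ => Filter.Eventually.of_forall fun _ => rfl, fun h => h.mono fun _ => Eq.symm,
      fun h h' => (h.and h').mono fun _ h => h.1.trans h.2⟩

theorem hull_mk_eq {σ : Sg.Sorts} {e e' : SkolemTerm Sg G σ} :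
    Quotient.mk (hullSetoid U A a σ) e = Quotient.mk _ e' ↔
      ∀ᶠ i in U, e.eval (A i) (a i) = e'.eval (A i) (a i) :=
  Quotient.eq (r := hullSetoid U A a σ)

theorem eventually_eval_out {σ : Sg.Sorts} (e : SkolemTerm Sg G σ) :
    ∀ᶠ i in U, (Quotient.mk (hullSetoid U A a σ) e).out.eval (A i) (a i) =
      e.eval (A i) (a i) := by
  rw [← hull_mk_eq U A a, Quotient.out_eq]

/-- The substructure of the ultraproduct whose elements are the values of Skolem terms. -/
noncomputable def hull : Interp Sg where
  dom σ := Quotient (hullSetoid U A a σ)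
  dom_nonempty σ := ⟨Quotient.mk _ (.var ⟨σ, 0⟩)⟩
  func f q := Quotient.mk _ (.app f fun i => (q i).out)
  pred P := {q | ∀ᶠ i in U, (fun k => (q k).out.eval (A i) (a i)) ∈ (A i).pred P}
  val x := Quotient.mk _ (.var x)

/-- Functions of the hull act on chosen representatives, which agree with the intended values only
almost everywhere. Finite arity allows the exceptional sets of all arguments to be discarded
together. -/
theorem value_hull (v : (x : Var Sg) → SkolemTerm Sg G x.1) {σ : Sg.Sorts} (t : Term Sg σ) :
    ∃ e : SkolemTerm Sg G σ,
      t.value (hull U A a).toStruct (fun x => Quotient.mk (hullSetoid U A a x.1) (v x)) =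
        Quotient.mk (hullSetoid U A a σ) e ∧
      ∀ᶠ i in U, e.eval (A i) (a i) =
        t.value (A i).toStruct fun x => (v x).eval (A i) (a i) := by
  induction t with
  | var σ n => exact ⟨v ⟨σ, n⟩, rfl, Filter.Eventually.of_forall fun _ => rfl⟩
  | app f args ih =>
    choose e he hev using ih
    refine ⟨.app f fun k => (Quotient.mk (hullSetoid U A a _) (e k)).out, ?_, ?_⟩
    · simp only [Term.value, he]
      rfl
    · have h₁ := Filter.eventually_all.2 hev
      have h₂ := Filter.eventually_all.2 fun k => eventually_eval_out U A a (e k)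
      filter_upwards [h₁, h₂] with i h₁ h₂
      simp only [SkolemTerm.eval, Term.value, h₁, h₂]

/-- Łoś's theorem for the Skolem hull. -/
theorem holds_hull (φ : Formula Sg) (v : (x : Var Sg) → SkolemTerm Sg G x.1) :
    φ.Holds (hull U A a).toStruct (fun x => Quotient.mk (hullSetoid U A a x.1) (v x)) ↔
      ∀ᶠ i in U, φ.Holds (A i).toStruct fun x => (v x).eval (A i) (a i) := by
  induction φ generalizing v with
  | falsum => simp [Formula.Holds, U.neBot.ne]
  | equal s t =>
    obtain ⟨e, he, hev⟩ := value_hull U A a v s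
    obtain ⟨e', he', hev'⟩ := value_hull U A a v t
    simp only [Formula.Holds]
    rw [he, he']
    refine (hull_mk_eq U A a).trans (Filter.eventually_congr ?_)
    filter_upwards [hev, hev'] with i h h'
    rw [h, h']
  | pred P args =>
    choose e he hev using fun k => value_hull U A a v (args k)
    simp only [Formula.Holds, he]
    refine Filter.eventually_congr ?_
    have h₁ := Filter.eventually_all.2 hev
    have h₂ := Filter.eventually_all.2 fun k => eventually_eval_out U A a (e k)
    filter_upwards [h₁, h₂] with i h₁ h₂
    simp only [h₁, h₂]
  | imp φ ψ ih₁ ih₂ =>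
    simp only [Formula.Holds, ih₁, ih₂]
    exact Ultrafilter.eventually_imp.symm
  | all x φ ih =>
    classical
    have hupd : ∀ d : SkolemTerm Sg G x.1,
        Function.update (fun x => Quotient.mk (hullSetoid U A a x.1) (v x)) x
          (Quotient.mk (hullSetoid U A a x.1) d) =
        fun y => Quotient.mk (hullSetoid U A a y.1) (Function.update v x d y) := by
      intro d
      funext y
      by_cases h : y = x
      · subst h; simp
      · simp [Function.update_of_ne h]
    have hupd' : ∀ (d : SkolemTerm Sg G x.1) (i : ι),
        (fun y => (Function.update v x d y).eval (A i) (a i)) =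
        Function.update (fun y => (v y).eval (A i) (a i)) x (d.eval (A i) (a i)) := by
      intro d i
      funext y
      by_cases h : y = x
      · subst h; simp
      · simp [Function.update_of_ne h]
    have key : ∀ d : SkolemTerm Sg G x.1, φ.Holds (hull U A a).toStruct
        (Function.update (fun x => Quotient.mk (hullSetoid U A a x.1) (v x)) x
          (Quotient.mk (hullSetoid U A a x.1) d)) ↔ ∀ᶠ i in U, φ.Holds (A i).toStruct
        (Function.update (fun y => (v y).eval (A i) (a i)) x (d.eval (A i) (a i))) := by
      intro d
      have := ih (Function.update v x d)
      simp only [hupd'] at this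
      rw [← this]
      exact iff_of_eq (congrArg (fun w => φ.Holds (hull U A a).toStruct w) (hupd d))
    constructor
    · intro h
      -- If `φ` holds at its own Skolem counterexample, it has no counterexample at all.
      have h' := (key (.skolem φ x fun y => v y)).1 (h _)
      filter_upwards [h'] with i hi
      by_contra hcon
      exact SkolemTerm.not_holds_counterexample hcon hi
    · intro h q
      induction q using Quotient.inductionOn with | _ d
      exact (key d).2 (h.mono fun i hi => hi _)

theorem sat_hull {φ : Formula Sg} : (hull U A a).Sat φ ↔ ∀ᶠ i in U, (A i).Sat φ :=
  holds_hull U A a φ SkolemTerm.var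

theorem models_hull {T : Theory Sg} (h : ∀ i, T.Models (A i)) : T.Models (hull U A a) :=
  fun φ hφ => (sat_hull U A a).2 (Filter.Eventually.of_forall fun i => h i φ hφ)

end Hull

/-! ### Stable infiniteness by an ultraproduct -/

namespace Theory

variable {T : Theory Sg} {S : Set Sg.Sorts}

/-- Finite smoothness gives models of size `N + k` for all `k`. In the `k`-th one the first `k`
generators are distinct, so any two generators differ for almost all `k` and remain distinct in the
hull. -/
theorem StablyFinite.stablyInfinite (h : T.StablyFinite S) (hfs : T.FinitelySmooth S)
    (hS : S.Finite) : T.StablyInfinite S := by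
  classical
  rintro φ hφ ⟨A, hA, hs⟩
  obtain ⟨B, hB, hBs, hBc⟩ := h φ hφ A hA hs
  have hN : ∃ N : ℕ, ∀ σ ∈ S, Cardinal.mk (B.dom σ) ≤ N := by
    choose! n hn using fun σ hσ => Cardinal.lt_aleph0.1 (hBc σ hσ).1
    refine ⟨hS.toFinset.sup n, fun σ hσ => ?_⟩
    rw [hn σ hσ]
    exact_mod_cast Finset.le_sup (hS.mem_toFinset.2 hσ)
  obtain ⟨N, hN⟩ := hN
  choose C hC hCs hCc using fun k : ℕ => hfs φ hφ B hB hBs (fun _ => ((N + k : ℕ) : Cardinal))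
    (fun σ => (hN σ σ.2).trans (by exact_mod_cast Nat.le_add_right N k))
    (fun _ => Cardinal.natCast_lt_aleph0)
  have hinj : ∀ k, ∀ σ, ∃ f : ULift.{u} ℕ → (C k).dom σ, σ ∈ S → Set.InjOn (f ∘ ULift.up)
      (Set.Iio k) := by
    intro k σ
    have := (C k).dom_nonempty σ
    by_cases hσ : σ ∈ S
    · have hle : Cardinal.mk (ULift.{u} (Fin k)) ≤ Cardinal.mk ((C k).dom σ) := by
        have hcard := hCc k ⟨σ, hσ⟩
        dsimp only at hcard
        rw [hcard, Cardinal.mk_uLift, Cardinal.mk_fin, Cardinal.lift_natCast]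
        exact_mod_cast Nat.le_add_left k N
      obtain ⟨g⟩ := hle
      refine ⟨fun n => if h : n.down < k then g ⟨⟨n.down, h⟩⟩ else Classical.arbitrary _,
        fun _ m hm n hn hmn => ?_⟩
      rw [Set.mem_Iio] at hm hn
      simp only [Function.comp, dif_pos hm, dif_pos hn] at hmn
      simpa using g.injective hmn
    · exact ⟨fun _ => Classical.arbitrary _, fun h' => absurd h' hσ⟩
  choose f hf using hinj
  refine ⟨hull (Filter.hyperfilter ℕ) C (G := fun _ => ULift.{u} ℕ) f, models_hull _ _ _ hC,
    (sat_hull _ _ _).2 (Filter.Eventually.of_forall hCs), fun σ hσ => ?_⟩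
  rw [← Cardinal.infinite_iff]
  refine Infinite.of_injective (fun n : ℕ => (Quotient.mk _ (.gen ⟨n⟩) :
    Quotient (hullSetoid (Filter.hyperfilter ℕ : Ultrafilter ℕ) C f σ))) fun m n hmn => ?_
  have hev := (hull_mk_eq _ _ _).1 hmn
  have hlarge : ∀ᶠ k in (Filter.hyperfilter ℕ : Filter ℕ), max m n < k :=
    Nat.hyperfilter_le_atTop (Filter.eventually_gt_atTop _)
  obtain ⟨k, hk, hlt⟩ := (hev.and hlarge).exists
  exact hf k σ hσ (lt_of_le_of_lt (le_max_left m n) hlt) (lt_of_le_of_lt (le_max_right m n) hlt) hk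

end Theory


/-! ### Ramsey's theorem for finite sets -/

/-- `n` is large enough for colourings of `k`-sets with colours in `K` to have homogeneous
sets of size `m`. -/
def RamseyBound (K : Type*) (k m n : ℕ) : Prop :=
  ∀ X : Finset ℕ, n ≤ X.card → ∀ c : Finset ℕ → K, ∃ Y ⊆ X, Y.card = m ∧
    ∀ A ⊆ Y, ∀ B ⊆ Y, A.card = k → B.card = k → c A = c B

/-- The Erdős–Rado argument: remove the least element `z`, find a homogeneous set for the colouring
of `k`-sets `A` by `c (insert z A)`, and continue inside it. The colour of a `(k + 1)`-set then
depends only on its least element. -/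
theorem exists_prehomogeneous {K : Type*} {k : ℕ} (hk : ∀ m, ∃ n, RamseyBound K k m n) (p : ℕ) :
    ∃ n, ∀ X : Finset ℕ, n ≤ X.card → ∀ c : Finset ℕ → K, ∃ Z ⊆ X, Z.card = p ∧
      ∃ d : ℕ → K, ∀ z ∈ Z, ∀ A ⊆ Z, (∀ a ∈ A, z < a) → A.card = k → c (insert z A) = d z := by
  induction p with
  | zero => exact ⟨0, fun X _ c => ⟨∅, by simp, rfl, fun _ => c ∅, by simp⟩⟩
  | succ p ih =>
    obtain ⟨n, hn⟩ := ih
    obtain ⟨n', hn'⟩ := hk n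
    refine ⟨n' + 1, fun X hX c => ?_⟩
    have hne : X.Nonempty := Finset.card_pos.1 (by omega)
    set z := X.min' hne
    have hz : z ∈ X := X.min'_mem hne
    obtain ⟨Y, hYX, hYc, hY⟩ := hn' (X.erase z) (by rw [Finset.card_erase_of_mem hz]; omega)
      fun A => c (insert z A)
    obtain ⟨Z, hZY, hZc, d, hd⟩ := hn Y hYc.ge c
    have hZX : Z ⊆ X.erase z := hZY.trans hYX
    have hlt : ∀ a ∈ Z, z < a := fun a ha =>
      lt_of_le_of_ne (X.min'_le a (Finset.mem_of_mem_erase (hZX ha)))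
        (Finset.ne_of_mem_erase (hZX ha)).symm
    have hzZ : z ∉ Z := fun h => lt_irrefl _ (hlt z h)
    have hcol : ∃ col, ∀ A ⊆ Y, A.card = k → c (insert z A) = col := by
      by_cases h : ∃ B ⊆ Y, B.card = k
      · obtain ⟨B, hB, hBc⟩ := h
        exact ⟨_, fun A hA hAc => hY A hA B hB hAc hBc⟩
      -- Without `k`-subsets any colour serves; `c ∅` is one that is at hand.
      · exact ⟨c ∅, fun A hA hAc => absurd ⟨A, hA, hAc⟩ h⟩
    obtain ⟨col, hcol⟩ := hcol
    refine ⟨insert z Z, Finset.insert_subset hz (hZX.trans (Finset.erase_subset _ _)), ?_,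
      Function.update d z col, fun y hy A hA hAl hAc => ?_⟩
    · rw [Finset.card_insert_of_notMem hzZ, hZc]
    · have hzA : z ∉ A := fun h => by
        have h' := hAl z h
        rcases Finset.mem_insert.1 hy with rfl | hy
        · exact lt_irrefl _ h'
        · exact lt_asymm h' (hlt y hy)
      have hAZ : A ⊆ Z := (Finset.subset_insert_iff_of_notMem hzA).1 hA
      rcases Finset.mem_insert.1 hy with rfl | hy
      · rw [Function.update_self]
        exact hcol A (hAZ.trans hZY) hAc
      · rw [Function.update_of_ne (ne_of_mem_of_not_mem hy hzZ)]
        exact hd y hy A hAZ hAl hAc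

/-- In a prehomogeneous set of size `Fintype.card K * m`, the pigeonhole principle finds `m`
elements with the same colour `d`. -/
theorem exists_ramseyBound (K : Type*) [Finite K] (k m : ℕ) : ∃ n, RamseyBound K k m n := by
  induction k generalizing m with
  | zero =>
    refine ⟨m, fun X hX c => ?_⟩
    obtain ⟨Y, hY, hYc⟩ := Finset.exists_subset_card_eq hX
    refine ⟨Y, hY, hYc, fun A _ B _ hA hB => ?_⟩
    rw [Finset.card_eq_zero.1 hA, Finset.card_eq_zero.1 hB]
  | succ k ih =>
    classical
    have := Fintype.ofFinite K
    obtain ⟨n, hn⟩ := exists_prehomogeneous ih (Fintype.card K * m)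
    refine ⟨n, fun X hX c => ?_⟩
    have : Nonempty K := ⟨c ∅⟩
    obtain ⟨Z, hZX, hZc, d, hd⟩ := hn X hX c
    obtain ⟨col, -, hcol⟩ := Finset.exists_le_card_fiber_of_mul_le_card_of_maps_to
      (s := Z) (t := Finset.univ) (f := d) (fun _ _ => Finset.mem_univ _)
      Finset.univ_nonempty (by rw [Finset.card_univ, hZc])
    obtain ⟨Y, hY, hYc⟩ := Finset.exists_subset_card_eq hcol
    have key : ∀ A ⊆ Y, A.card = k + 1 → c A = col := by
      intro A hA hAc
      have hne : A.Nonempty := Finset.card_pos.1 (by omega)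
      have hmem := A.min'_mem hne
      have hAZ : A ⊆ Z := hA.trans (hY.trans (Finset.filter_subset _ _))
      have := hd _ (hAZ hmem) (A.erase (A.min' hne)) ((Finset.erase_subset _ _).trans hAZ)
        (fun a ha => A.min'_lt_of_mem_erase_min' hne ha)
        (by rw [Finset.card_erase_of_mem hmem, hAc]; rfl)
      rw [Finset.insert_erase hmem] at this
      rw [this]
      exact (Finset.mem_filter.1 (hY (hA hmem))).2
    exact ⟨Y, hY.trans ((Finset.filter_subset _ _).trans hZX), hYc,
      fun A hA B hB hAc hBc => (key A hA hAc).trans (key B hB hBc).symm⟩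

/-- Ramsey's theorem for colourings of all finite sets. -/
theorem exists_ramseyBound_all (K : Type*) [Finite K] (m : ℕ) :
    ∃ n, ∀ X : Finset ℕ, n ≤ X.card → ∀ c : Finset ℕ → K, ∃ Y ⊆ X, Y.card = m ∧
      ∀ A ⊆ Y, ∀ B ⊆ Y, A.card = B.card → c A = c B := by
  have key : ∀ t p, ∃ n, ∀ X : Finset ℕ, n ≤ X.card → ∀ c : Finset ℕ → K, ∃ Y ⊆ X, Y.card = p ∧
      ∀ A ⊆ Y, ∀ B ⊆ Y, A.card = B.card → A.card < t → c A = c B := by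
    intro t
    induction t with
    | zero =>
      refine fun p => ⟨p, fun X hX c => ?_⟩
      obtain ⟨Y, hY, hYc⟩ := Finset.exists_subset_card_eq hX
      exact ⟨Y, hY, hYc, fun A _ B _ _ h => absurd h (Nat.not_lt_zero _)⟩
    | succ t ih =>
      intro p
      obtain ⟨n', hn'⟩ := exists_ramseyBound K t p
      obtain ⟨n, hn⟩ := ih n'
      refine ⟨n, fun X hX c => ?_⟩
      obtain ⟨Y, hYX, hYc, hY⟩ := hn X hX c
      obtain ⟨Y', hYY, hYc', hY'⟩ := hn' Y hYc.ge c
      refine ⟨Y', hYY.trans hYX, hYc', fun A hA B hB hAB hAt => ?_⟩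
      rcases Nat.lt_succ_iff_lt_or_eq.1 hAt with hlt | heq
      · exact hY A (hA.trans hYY) B (hB.trans hYY) hAB hlt
      · exact hY' A hA B hB heq (hAB ▸ heq)
  -- Subsets of an `m`-element set have cardinality below `m + 1`.
  obtain ⟨n, hn⟩ := key (m + 1) m
  refine ⟨n, fun X hX c => ?_⟩
  obtain ⟨Y, hYX, hYc, hY⟩ := hn X hX c
  exact ⟨Y, hYX, hYc, fun A hA B hB hAB =>
    hY A hA B hB hAB (Nat.lt_succ_of_le ((Finset.card_le_card hA).trans_eq hYc))⟩

/-- A product version of Ramsey's theorem: if the sizes `N i` grow fast enough along `κ`, then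
functions `t j` to `{0, …, N j - 1}` of families of finite sets do not depend on the components
`i` with `κ j < κ i`, up to cardinality, on families of large subsets `H i`. -/
theorem exists_ramsey_product_list {I : Type*} [Finite I] {C : Type*} [LinearOrder C] (κ : I → C)
    (l : List I) (hnd : l.Nodup) (hl : l.Pairwise fun i j => κ j ≤ κ i) (Q : Type w) [Finite Q]
    (m : ℕ) :
    ∃ N : I → ℕ, (∀ i ∈ l, m ≤ N i) ∧
      ∀ t : I → (I → Finset ℕ) → Q → ℕ, (∀ j ∈ l, ∀ F q, t j F q < N j) →
      ∃ H : I → Finset ℕ, (∀ i ∈ l, H i ⊆ Finset.range (N i) ∧ (H i).card = m) ∧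
        ∀ j ∈ l, ∀ F F' : I → Finset ℕ, (∀ i ∉ l, F i = ∅ ∧ F' i = ∅) →
          (∀ i ∈ l, F i ⊆ H i ∧ F' i ⊆ H i ∧ (F i).card = (F' i).card ∧
            (κ i ≤ κ j → F i = F' i)) → t j F = t j F' := by
  classical
  induction l generalizing Q with
  | nil => exact ⟨fun _ => 0, by simp, fun t _ => ⟨fun _ => ∅, by simp, by simp⟩⟩
  | cons i₀ l ih =>
    have := Fintype.ofFinite I
    rw [List.nodup_cons] at hnd
    rw [List.pairwise_cons] at hl
    -- The head `i₀` has the largest `κ`, so its size is chosen last and may depend on the others.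
    -- The new parameter in `Fin (m + 1)` records the cardinality of the component at `i₀`.
    obtain ⟨N', hm, hN'⟩ := ih hnd.2 hl.2 (Q × Fin (m + 1))
    let P : Finset (I → Finset ℕ) :=
      Fintype.piFinset fun i => if i ∈ l then (Finset.range (N' i)).powerset else {∅}
    let b := Finset.univ.sup N'
    obtain ⟨n, hn⟩ := exists_ramseyBound_all (P → I → Q → Fin (b + 1)) m
    have hne : ∀ j ∈ l, j ≠ i₀ := fun j hj e => hnd.1 (e ▸ hj)
    refine ⟨Function.update N' i₀ (max n m), fun i hi => ?_, fun t ht => ?_⟩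
    · rcases List.mem_cons.1 hi with rfl | hi
      · simp
      · rw [Function.update_of_ne (hne i hi)]
        exact hm i hi
    have htN : ∀ j ∈ l, ∀ F q, t j F q < N' j := fun j hj F q => by
      have := ht j (List.mem_cons_of_mem _ hj) F q
      rwa [Function.update_of_ne (hne j hj)] at this
    obtain ⟨H₀, hH₀, hH₀c, hH₀h⟩ := hn (Finset.range (max n m))
      ((le_max_left n m).trans (Finset.card_range _).ge)
      -- A finite set `B` is coloured by all values of `t` at once. Reduction modulo `b + 1` makes
      -- the palette finite and loses nothing for `j ∈ l`, where the values are below `N' j`.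
      fun B F j q => Fin.ofNat (b + 1) (t j (Function.update F.1 i₀ B) q)
    have hB : ∀ s : Fin (m + 1), ∃ B ⊆ H₀, B.card = s := fun s =>
      Finset.exists_subset_card_eq (by have := s.2; omega)
    choose B hBH hBc using hB
    obtain ⟨H', hH', hind⟩ := hN' (fun j F qs => t j (Function.update F i₀ (B qs.2)) qs.1)
      fun j hj F qs => htN j hj _ _
    have hupd : ∀ i ∈ l, Function.update H' i₀ H₀ i = H' i := fun i hi =>
      Function.update_of_ne (hne i hi) _ _
    refine ⟨Function.update H' i₀ H₀, ?_, ?_⟩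
    · intro i hi
      rcases List.mem_cons.1 hi with rfl | hi
      · simpa using ⟨hH₀, hH₀c⟩
      · rw [hupd i hi, Function.update_of_ne (hne i hi)]
        exact hH' i hi
    intro j hj F F' hout hin
    have hin₀ := hin i₀ (by simp)
    rw [Function.update_self] at hin₀
    rcases List.mem_cons.1 hj with rfl | hj
    -- For `j = i₀` every `κ i` is at most `κ j`, so the families coincide.
    · have : F = F' := by
        funext i
        by_cases hi : i ∈ j :: l
        · refine (hin i hi).2.2.2 ?_
          rcases List.mem_cons.1 hi with rfl | hi
          · exact le_rfl
          · exact hl.1 i hi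
        · rw [(hout i hi).1, (hout i hi).2]
      rw [this]
    -- replace the component at `i₀` by a standard one
    have std : ∀ F : I → Finset ℕ, (∀ i ∉ i₀ :: l, F i = ∅) → (∀ i ∈ l, F i ⊆ H' i) →
        F i₀ ⊆ H₀ → ∀ s : Fin (m + 1), (F i₀).card = s → ∀ q,
        t j F q = t j (Function.update (Function.update F i₀ ∅) i₀ (B s)) q := by
      intro F hF hFH hF₀ s hs q
      have hP : Function.update F i₀ ∅ ∈ P := by
        rw [Fintype.mem_piFinset]
        intro i
        by_cases hi : i ∈ l
        · rw [if_pos hi, Function.update_of_ne (hne i hi), Finset.mem_powerset]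
          exact (hFH i hi).trans (hH' i hi).1
        · rw [if_neg hi, Finset.mem_singleton]
          by_cases hi₀ : i = i₀
          · subst hi₀; simp
          · rw [Function.update_of_ne hi₀]
            exact hF i (by simp [hi, hi₀])
      have h := congrArg Fin.val (congrFun (congrFun (congrFun
        (hH₀h (F i₀) hF₀ (B s) (hBH s) (by rw [hs, hBc])) ⟨_, hP⟩) j) q)
      simp only [Fin.ofNat] at h
      have hb : ∀ F q, t j F q < b + 1 := fun F q =>
        (htN j hj F q).trans (Nat.lt_succ_of_le (Finset.le_sup (Finset.mem_univ j)))
      rw [Nat.mod_eq_of_lt (hb _ _), Nat.mod_eq_of_lt (hb _ _)] at h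
      rw [← h]
      simp
    have hlt : (F i₀).card < m + 1 :=
      Nat.lt_succ_of_le ((Finset.card_le_card hin₀.1).trans_eq hH₀c)
    have hinl : ∀ i ∈ l, _ := fun i hi => hin i (List.mem_cons_of_mem _ hi)
    funext q
    rw [std F (fun i hi => (hout i hi).1) (fun i hi => hupd i hi ▸ (hinl i hi).1) hin₀.1
        ⟨_, hlt⟩ rfl q,
      std F' (fun i hi => (hout i hi).2) (fun i hi => hupd i hi ▸ (hinl i hi).2.1) hin₀.2.1
        ⟨_, hlt⟩ hin₀.2.2.1.symm q]
    refine congrFun (hind j hj (Function.update F i₀ ∅) (Function.update F' i₀ ∅) ?_ ?_) (q, _)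
    · intro i hi
      by_cases hi₀ : i = i₀
      · subst hi₀; simp
      · simpa [Function.update_of_ne hi₀] using hout i (by simp [hi, hi₀])
    · intro i hi
      rw [Function.update_of_ne (hne i hi), Function.update_of_ne (hne i hi)]
      have := hinl i hi
      rwa [hupd i hi] at this

theorem exists_ramsey_product {I : Type*} [Finite I] {C : Type*} [LinearOrder C] (κ : I → C)
    (Q : Type w) [Finite Q] (m : ℕ) :
    ∃ N : I → ℕ, (∀ i, m ≤ N i) ∧
      ∀ t : I → (I → Finset ℕ) → Q → ℕ, (∀ j F q, t j F q < N j) →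
      ∃ H : I → Finset ℕ, (∀ i, H i ⊆ Finset.range (N i) ∧ (H i).card = m) ∧
        ∀ j, ∀ F F' : I → Finset ℕ, (∀ i, F i ⊆ H i ∧ F' i ⊆ H i ∧ (F i).card = (F' i).card ∧
            (κ i ≤ κ j → F i = F' i)) → t j F = t j F' := by
  classical
  have := Fintype.ofFinite I
  let r : I → I → Prop := fun i j => κ j ≤ κ i
  let l := (Finset.univ : Finset I).toList.insertionSort r
  have : IsTrans I r := ⟨fun _ _ _ h h' => le_trans h' h⟩
  have : Std.Total r := ⟨fun i j => le_total (κ j) (κ i)⟩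
  have hmem : ∀ i, i ∈ l := fun i => by simp [l]
  obtain ⟨N, hm, hN⟩ := exists_ramsey_product_list κ l
    ((List.perm_insertionSort r _).nodup_iff.2 (Finset.nodup_toList _))
    (List.pairwise_insertionSort r _) Q m
  refine ⟨N, fun i => hm i (hmem i), fun t ht => ?_⟩
  obtain ⟨H, hH, hind⟩ := hN t fun j _ => ht j
  exact ⟨H, fun i => hH i (hmem i), fun j F F' h =>
    hind j (hmem j) F F' (fun i hi => absurd (hmem i) hi) fun i _ => h i⟩

/-! ### Countability of the syntax -/

theorem countable_wType {α : Type v} {β : α → Type w} [Countable α] [∀ a, Finite (β a)] :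
    Countable (WType β) := by
  have : Encodable α := Encodable.ofCountable α
  have : ∀ a, Fintype (β a) := fun a => Fintype.ofFinite _
  have : ∀ a, Encodable (β a) := fun a => Encodable.ofCountable _
  infer_instance

/-- Returning the equality of labels separately allows `cases` to refute it or to identify the
constructors. -/
theorem wType_mk_inj {α : Type v} {β : α → Type w} {a a' : α} {f : β a → WType β}
    {f' : β a' → WType β} (h : WType.mk a f = WType.mk a' f') :
    ∃ e : a = a', ∀ b, f b = f' (cast (congrArg β e) b) := by
  cases h
  exact ⟨rfl, fun _ => rfl⟩

namespace Signature

theorem IsCountable.sorts (h : Sg.IsCountable) : Countable Sg.Sorts :=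
  have : Countable (Sg.Sorts ⊕ Sg.Funcs ⊕ Sg.Preds) := h
  (Sum.inl_injective (β := Sg.Funcs ⊕ Sg.Preds)).countable

theorem IsCountable.funcs (h : Sg.IsCountable) : Countable Sg.Funcs :=
  have : Countable (Sg.Sorts ⊕ Sg.Funcs ⊕ Sg.Preds) := h
  ((Sum.inr_injective (α := Sg.Sorts)).comp (Sum.inl_injective (β := Sg.Preds))).countable

theorem IsCountable.preds (h : Sg.IsCountable) : Countable Sg.Preds :=
  have : Countable (Sg.Sorts ⊕ Sg.Funcs ⊕ Sg.Preds) := h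
  ((Sum.inr_injective (α := Sg.Sorts)).comp (Sum.inr_injective (α := Sg.Funcs))).countable

end Signature

/-- The number of immediate subterms. -/
def TermArity (Sg : Signature.{u}) : Var Sg ⊕ Sg.Funcs → Type
  | .inl _ => Empty
  | .inr f => Fin (Sg.funArity f)

instance (s : Var Sg ⊕ Sg.Funcs) : Finite (TermArity Sg s) := by
  cases s <;> unfold TermArity <;> infer_instance

/-- The underlying tree of a term. -/
def Term.toTree : {σ : Sg.Sorts} → Term Sg σ → WType (TermArity Sg)
  | _, .var σ n => ⟨.inl ⟨σ, n⟩, Empty.elim⟩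
  | _, .app f args => ⟨.inr f, fun i => (args i).toTree⟩

theorem Term.toTree_injective {σ : Sg.Sorts} (t : Term Sg σ) {τ : Sg.Sorts} (t' : Term Sg τ)
    (h : t.toTree = t'.toTree) : (⟨σ, t⟩ : Σ σ, Term Sg σ) = ⟨τ, t'⟩ := by
  induction t generalizing τ with
  | var σ n =>
    cases t' <;> obtain ⟨e, -⟩ := wType_mk_inj h <;> cases e
    rfl
  | app f args ih =>
    cases t' <;> obtain ⟨e, hargs⟩ := wType_mk_inj h <;> cases e
    rename_i args'
    have : args = args' := funext fun i => by
      simpa using ih i (args' i) (hargs i)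
    rw [this]

theorem countable_term (h : Sg.IsCountable) : Countable (Σ σ, Term Sg σ) := by
  have := h.sorts
  have := h.funcs
  have : Countable (WType (TermArity Sg)) := countable_wType
  exact Function.Injective.countable (f := fun t : Σ σ, Term Sg σ => t.2.toTree)
    fun t t' h => Term.toTree_injective t.2 t'.2 h

/-- The constructors of formulas with their arguments other than formulas. -/
inductive FormulaShape (Sg : Signature.{u}) : Type u
  | falsum : FormulaShape Sg
  | equal (σ : Sg.Sorts) (s t : Term Sg σ) : FormulaShape Sg
  | pred (P : Sg.Preds) (args : (i : Fin (Sg.predArity P)) → Term Sg (Sg.predDom P i)) :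
      FormulaShape Sg
  | imp : FormulaShape Sg
  | all (x : Var Sg) : FormulaShape Sg

theorem countable_formulaShape (h : Sg.IsCountable) : Countable (FormulaShape Sg) := by
  have := h.sorts
  have := h.preds
  have := countable_term h
  have hterm : ∀ σ, Countable (Term Sg σ) := fun σ =>
    (sigma_mk_injective (i := σ) (β := fun σ => Term Sg σ)).countable
  let f : (Unit ⊕ (Σ σ, Term Sg σ × Term Sg σ)) ⊕
      (Σ P, (i : Fin (Sg.predArity P)) → Term Sg (Sg.predDom P i)) ⊕ (Unit ⊕ Var Sg) →
      FormulaShape Sg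
    | .inl (.inl _) => .falsum
    | .inl (.inr ⟨σ, s, t⟩) => .equal σ s t
    | .inr (.inl ⟨P, args⟩) => .pred P args
    | .inr (.inr (.inl _)) => .imp
    | .inr (.inr (.inr x)) => .all x
  refine Function.Surjective.countable (f := f) fun s => ?_
  cases s with
  | falsum => exact ⟨.inl (.inl ()), rfl⟩
  | equal σ s t => exact ⟨.inl (.inr ⟨σ, s, t⟩), rfl⟩
  | pred P args => exact ⟨.inr (.inl ⟨P, args⟩), rfl⟩
  | imp => exact ⟨.inr (.inr (.inl ())), rfl⟩
  | all x => exact ⟨.inr (.inr (.inr x)), rfl⟩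

/-- The number of immediate subformulas. -/
def FormulaArity (Sg : Signature.{u}) : FormulaShape Sg → Type
  | .falsum => Fin 0
  | .equal _ _ _ => Fin 0
  | .pred _ _ => Fin 0
  | .imp => Fin 2
  | .all _ => Fin 1

instance (s : FormulaShape Sg) : Finite (FormulaArity Sg s) := by
  cases s <;> unfold FormulaArity <;> infer_instance

/-- The underlying tree of a formula. -/
def Formula.toTree : Formula Sg → WType (FormulaArity Sg)
  | .falsum => ⟨.falsum, Fin.elim0⟩
  | .equal s t => ⟨.equal _ s t, Fin.elim0⟩
  | .pred P args => ⟨.pred P args, Fin.elim0⟩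
  | .imp φ ψ => ⟨.imp, fun i : Fin 2 => if i = 0 then φ.toTree else ψ.toTree⟩
  | .all x φ => ⟨.all x, fun _ => φ.toTree⟩

theorem Formula.toTree_injective : Function.Injective (Formula.toTree (Sg := Sg)) := by
  intro φ
  induction φ with
  | falsum | equal | pred =>
    intro ψ h
    cases ψ <;> obtain ⟨e, -⟩ := wType_mk_inj h <;> cases e
    rfl
  | imp φ₁ φ₂ ih₁ ih₂ =>
    intro ψ h
    cases ψ <;> obtain ⟨e, hargs⟩ := wType_mk_inj h <;> cases e
    rw [ih₁ (hargs (0 : Fin 2)), ih₂ (hargs (1 : Fin 2))]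
  | all x φ ih =>
    intro ψ h
    cases ψ <;> obtain ⟨e, hargs⟩ := wType_mk_inj h <;> cases e
    rw [ih (hargs (0 : Fin 1))]

theorem countable_formula (h : Sg.IsCountable) : Countable (Formula Sg) := by
  have := countable_formulaShape h
  have : Countable (WType (FormulaArity Sg)) := countable_wType
  exact Formula.toTree_injective.countable

/-- The number of immediate subterms of a Skolem term. -/
def SkolemArity (Sg : Signature.{u}) (G : Sg.Sorts → Type u) :
    ((Σ σ, G σ) ⊕ Var Sg) ⊕ (Sg.Funcs ⊕ (Formula Sg × Var Sg)) → Type u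
  | .inl _ => PEmpty
  | .inr (.inl f) => ULift (Fin (Sg.funArity f))
  | .inr (.inr p) => p.1.vars

variable {G : Sg.Sorts → Type u}

instance (s : ((Σ σ, G σ) ⊕ Var Sg) ⊕ (Sg.Funcs ⊕ (Formula Sg × Var Sg))) :
    Finite (SkolemArity Sg G s) := by
  rcases s with s | s | s <;> unfold SkolemArity <;> infer_instance

/-- The underlying tree of a Skolem term. -/
def SkolemTerm.toTree : {σ : Sg.Sorts} → SkolemTerm Sg G σ → WType (SkolemArity Sg G)
  | _, .gen g => ⟨.inl (.inl ⟨_, g⟩), PEmpty.elim⟩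
  | _, .var x => ⟨.inl (.inr x), PEmpty.elim⟩
  | _, .app f args => ⟨.inr (.inl f), fun i : ULift (Fin _) => (args i.down).toTree⟩
  | _, .skolem φ x args => ⟨.inr (.inr (φ, x)), fun y : φ.vars => (args y).toTree⟩

theorem SkolemTerm.toTree_injective {σ : Sg.Sorts} (t : SkolemTerm Sg G σ) {τ : Sg.Sorts}
    (t' : SkolemTerm Sg G τ) (h : t.toTree = t'.toTree) :
    (⟨σ, t⟩ : Σ σ, SkolemTerm Sg G σ) = ⟨τ, t'⟩ := by
  induction t generalizing τ with
  | gen | var =>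
    cases t' <;> obtain ⟨e, -⟩ := wType_mk_inj h <;> cases e
    rfl
  | app f args ih =>
    cases t' <;> obtain ⟨e, hargs⟩ := wType_mk_inj h <;> cases e
    rename_i args'
    have : args = args' := funext fun i => by
      simpa using ih i (args' i) (hargs (ULift.up i))
    rw [this]
  | skolem φ x args ih =>
    cases t' <;> obtain ⟨e, hargs⟩ := wType_mk_inj h <;> cases e
    rename_i args'
    have : args = args' := funext fun i => by
      simpa using ih i (args' i) (hargs i)
    rw [this]

theorem countable_skolemTerm (h : Sg.IsCountable) [∀ σ, Countable (G σ)] :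
    Countable (Σ σ, SkolemTerm Sg G σ) := by
  have := h.sorts
  have := h.funcs
  have := countable_formula h
  have : Countable (WType (SkolemArity Sg G)) := countable_wType
  exact Function.Injective.countable (f := fun t : Σ σ, SkolemTerm Sg G σ => t.2.toTree)
    fun t t' h => SkolemTerm.toTree_injective t.2 t'.2 h

/-! ### Increasing enumerations of finite sets -/

section Enum

variable {α : Type*} {β : Type*} [LinearOrder α] [LinearOrder β]

/-- The `k`-th element of a finite set in increasing order, if it exists. -/
def kth (F : Finset α) (k : ℕ) : Option α :=
  if h : k < F.card then some (F.orderEmbOfFin rfl ⟨k, h⟩) else none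

theorem kth_eq {F : Finset α} {n : ℕ} (hn : F.card = n) (k : ℕ) :
    kth F k = if h : k < n then some (F.orderEmbOfFin hn ⟨k, h⟩) else none := by
  subst hn; rfl

theorem kth_card (F : Finset α) : kth F F.card = none := dif_neg (lt_irrefl _)

theorem exists_kth_eq {F : Finset α} {a : α} (ha : a ∈ F) : ∃ k, kth F k = some a := by
  obtain ⟨i, rfl⟩ : a ∈ Set.range (F.orderEmbOfFin rfl) := by
    rw [Finset.range_orderEmbOfFin]; exact ha
  exact ⟨i, dif_pos i.2⟩

theorem kth_image {F : Finset α} {f : α → β} (hf : StrictMonoOn f F) (k : ℕ) :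
    kth (F.image f) k = (kth F k).map f := by
  have hcard : (F.image f).card = F.card := Finset.card_image_of_injOn hf.injOn
  have hmem : ∀ i, F.orderEmbOfFin rfl i ∈ F := fun i => Finset.orderEmbOfFin_mem F rfl i
  have := Finset.orderEmbOfFin_unique hcard (f := fun i => f (F.orderEmbOfFin rfl i))
    (fun i => Finset.mem_image_of_mem f (hmem i))
    (fun i j hij => hf (hmem i) (hmem j) ((F.orderEmbOfFin rfl).strictMono hij))
  rw [kth_eq hcard, kth, ← this]
  split_ifs <;> rfl

theorem exists_strictMonoOn_mapsTo {Φ : Finset α} {H : Finset ℕ} (h : Φ.card ≤ H.card) :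
    ∃ f : α → ℕ, StrictMonoOn f Φ ∧ ∀ a ∈ Φ, f a ∈ H := by
  classical
  let e := Φ.orderIsoOfFin rfl
  refine ⟨fun a => if ha : a ∈ Φ then
    H.orderEmbOfFin rfl (Fin.castLE h (e.symm ⟨a, ha⟩)) else 0, fun a ha b hb hab => ?_,
    fun a ha => ?_⟩
  · rw [Finset.mem_coe] at ha hb
    simp only [dif_pos ha, dif_pos hb]
    exact (H.orderEmbOfFin rfl).strictMono (Fin.strictMono_castLE h (e.symm.strictMono hab))
  · simp only [dif_pos ha]
    exact Finset.orderEmbOfFin_mem _ _ _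

end Enum

/-! ### Slot terms and indiscernible generators -/

/-- Skolem terms over slots for generators. -/
abbrev SlotTerm (Sg : Signature.{u}) : Sg.Sorts → Type u :=
  SkolemTerm Sg fun _ => ULift.{u} ℕ

/-- Fill the slots with the increasing enumerations of the finite sets `F σ`. -/
abbrev SkolemTerm.fill {L : Sg.Sorts → Type u} [∀ σ, LinearOrder (L σ)]
    (F : ∀ σ, Finset (L σ)) {σ : Sg.Sorts} (e : SlotTerm Sg σ) :
    SkolemTerm Sg (fun σ => Option (L σ)) σ :=
  e.map fun τ k => kth (F τ) k.down

/-- Every Skolem term arises from a slot term by filling in a finite set of generators. -/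
theorem SkolemTerm.exists_fill {L : Sg.Sorts → Type u} [∀ σ, LinearOrder (L σ)] {σ : Sg.Sorts}
    (e : SkolemTerm Sg (fun σ => Option (L σ)) σ) :
    ∃ F₀ : ∀ σ, Finset (L σ), ∀ F : ∀ σ, Finset (L σ), F₀ ≤ F →
      ∃ e' : SlotTerm Sg σ, e'.fill F = e := by
  classical
  induction e with
  | @gen τ g =>
    cases g with
    | none =>
      -- The slot just past the end of the enumeration is filled with the dummy generator `none`.
      exact ⟨⊥, fun F _ => ⟨.gen ⟨(F τ).card⟩, by simp only [map, kth_card]⟩⟩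
    | some g =>
      refine ⟨Function.update ⊥ τ {g}, fun F hF => ?_⟩
      have hg : g ∈ F τ := hF τ (by simp)
      obtain ⟨k, hk⟩ := exists_kth_eq hg
      exact ⟨.gen ⟨k⟩, by simp only [map, hk]⟩
  | var x => exact ⟨⊥, fun F _ => ⟨.var x, rfl⟩⟩
  | app f args ih =>
    choose F₀ hF₀ using ih
    refine ⟨Finset.univ.sup F₀, fun F hF => ?_⟩
    choose e' he' using fun i => hF₀ i F ((Finset.le_sup (Finset.mem_univ i)).trans hF)
    exact ⟨.app f e', by simp only [fill, map] at he' ⊢; simp only [he']⟩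
  | skolem φ x args ih =>
    choose F₀ hF₀ using ih
    refine ⟨Finset.univ.sup F₀, fun F hF => ?_⟩
    choose e' he' using fun i => hF₀ i F ((Finset.le_sup (Finset.mem_univ i)).trans hF)
    exact ⟨.skolem φ x e', by simp only [fill, map] at he' ⊢; simp only [he']⟩

theorem exists_code {α : Type u} {n : ℕ} (h : Cardinal.mk α = n) (a : α) :
    ∃ (code : α → ℕ) (enum : ℕ → α), (∀ x, code x < n ∧ enum (code x) = x) ∧
      ∀ k < n, code (enum k) = k := by
  obtain ⟨e⟩ : Nonempty (α ≃ ULift.{u} (Fin n)) := by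
    rw [← Cardinal.eq, h]; simp
  refine ⟨fun x => (e x).down, fun k => if hk : k < n then e.symm ⟨⟨k, hk⟩⟩ else a,
    fun x => ⟨(e x).down.2, ?_⟩, fun k hk => ?_⟩
  · exact (dif_pos (e x).down.2).trans (e.symm_apply_apply x)
  · simp [hk]

/-- If there are interpretations with property `P` and sorts in `J` of arbitrary large finite
sizes, then there is one with finite sequences of generators in these sorts such that the values
of given terms of sort `j` depend only on the generators of sorts `i` with `κ i ≤ κ j`. -/
theorem exists_indiscernible {P : Interp Sg → Prop} {J : Set Sg.Sorts} (hJ : J.Finite) {n₀ : ℕ}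
    (hP : ∀ n : J → ℕ, (∀ j, n₀ ≤ n j) → ∃ A, P A ∧ ∀ j : J, Cardinal.mk (A.dom j) = n j)
    {C : Type*} [LinearOrder C] (κ : Sg.Sorts → C)
    {L : Sg.Sorts → Type u} [∀ σ, LinearOrder (L σ)] (E : Finset (Σ σ, SlotTerm Sg σ))
    (Φ : ∀ σ, Finset (L σ)) :
    ∃ A, P A ∧ ∃ a : ∀ σ, Option (L σ) → A.dom σ,
      (∀ j ∈ J, Set.InjOn (fun g => a j (some g)) (Φ j)) ∧
      ∀ j ∈ J, ∀ e : SlotTerm Sg j, ⟨j, e⟩ ∈ E → ∀ F F' : ∀ σ, Finset (L σ),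
        (∀ i ∈ J, F i ⊆ Φ i ∧ F' i ⊆ Φ i ∧ (F i).card = (F' i).card ∧
          (κ i ≤ κ j → F i = F' i)) →
        (e.fill F).eval A a = (e.fill F').eval A a := by
  classical
  have := hJ.to_subtype
  have := Fintype.ofFinite J
  -- The sizes must reach `n₀` for `hP`, be positive for the default colour `0`, and leave room in
  -- each homogeneous set for a copy of `Φ j`.
  let m := max (max n₀ 1) (Finset.univ.sup fun j : J => (Φ j).card)
  obtain ⟨N, hmN, hN⟩ := exists_ramsey_product (fun j : J => κ j) E m
  obtain ⟨A, hA, hAc⟩ := hP N fun j =>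
    ((le_max_left _ _).trans (le_max_left _ _)).trans (hmN j)
  choose code enum hcode henum using fun j : J => exists_code (hAc j) (A.val ⟨j, 0⟩)
  let slot : (J → Finset ℕ) → ∀ σ, ULift.{u} ℕ → A.dom σ := fun F σ k =>
    if h : σ ∈ J then ((kth (F ⟨σ, h⟩) k.down).map (enum ⟨σ, h⟩)).getD (A.val ⟨σ, 0⟩)
    else A.val ⟨σ, 0⟩
  -- The colour is the code of the value of the term, hence below `N j`: this is what makes small
  -- sorts provide few colours.
  let t : J → (J → Finset ℕ) → E → ℕ := fun j F e =>
    if h : e.1.1 = j then code j (h ▸ e.1.2.eval A (slot F)) else 0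
  have ht : ∀ j F e, t j F e < N j := by
    intro j F e
    simp only [t]
    split_ifs
    · exact (hcode j _).1
    · exact ((le_max_right n₀ 1).trans (le_max_left _ _)).trans (hmN j)
  obtain ⟨H, hH, hind⟩ := hN t ht
  choose f hf hfH using fun j : J => exists_strictMonoOn_mapsTo (Φ := Φ j) (H := H j) (by
    rw [(hH j).2]
    exact (Finset.le_sup (f := fun j : J => (Φ j).card) (Finset.mem_univ j)).trans
      (le_max_right _ _))
  have hfN : ∀ j : J, ∀ g ∈ Φ j, f j g < N j := fun j g hg =>
    Finset.mem_range.1 ((hH j).1 (hfH j g hg))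
  let a : ∀ σ, Option (L σ) → A.dom σ := fun σ g =>
    if h : σ ∈ J then (g.map fun g => enum ⟨σ, h⟩ (f ⟨σ, h⟩ g)).getD (A.val ⟨σ, 0⟩)
    else A.val ⟨σ, 0⟩
  refine ⟨A, hA, a, fun j hj g hg g' hg' hgg => ?_, fun j hj e he F F' hF => ?_⟩
  · simp only [a, dif_pos hj, Option.map_some, Option.getD_some] at hgg
    have h := congrArg (code ⟨j, hj⟩) hgg
    rw [henum _ _ (hfN ⟨j, hj⟩ g hg), henum _ _ (hfN ⟨j, hj⟩ g' hg')] at h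
    exact (hf ⟨j, hj⟩).injOn hg hg' h
  -- Increasing maps commute with increasing enumeration, so generators from `Φ` can be replaced by
  -- their numbers in the homogeneous sets.
  have hfill : ∀ F : ∀ σ, Finset (L σ), (∀ i ∈ J, F i ⊆ Φ i) →
      (e.fill F).eval A a = e.eval A (slot fun j => (F j).image (f j)) := by
    intro F hFΦ
    rw [SkolemTerm.fill, SkolemTerm.eval_map]
    congr 1
    funext σ k
    simp only [a, slot]
    split_ifs with hσ
    · rw [kth_image ((hf ⟨σ, hσ⟩).mono (hFΦ σ hσ)), Option.map_map]
      rfl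
    · rfl
  have hfH' : ∀ F : ∀ σ, Finset (L σ), (∀ i ∈ J, F i ⊆ Φ i) → ∀ i : J,
      (F i).image (f i) ⊆ H i := by
    intro F hFΦ i x hx
    obtain ⟨g, hg, rfl⟩ := Finset.mem_image.1 hx
    exact hfH i g (hFΦ i i.2 hg)
  have hcard : ∀ F : ∀ σ, Finset (L σ), (∀ i ∈ J, F i ⊆ Φ i) → ∀ i : J,
      ((F i).image (f i)).card = (F i).card := fun F hFΦ i =>
    Finset.card_image_of_injOn ((hf i).mono (hFΦ i i.2)).injOn
  have h₁ : ∀ i ∈ J, F i ⊆ Φ i := fun i hi => (hF i hi).1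
  have h₂ : ∀ i ∈ J, F' i ⊆ Φ i := fun i hi => (hF i hi).2.1
  rw [hfill F h₁, hfill F' h₂]
  have h := congrFun (hind ⟨j, hj⟩ (fun i => (F i).image (f i)) (fun i => (F' i).image (f i))
    fun i => ⟨hfH' F h₁ i, hfH' F' h₂ i, by
      rw [hcard F h₁, hcard F' h₂]; exact (hF i i.2).2.2.1, fun hi => by
      rw [(hF i i.2).2.2.2 hi]⟩) ⟨⟨j, e⟩, he⟩
  simp only [t, dif_pos] at h
  have h' := congrArg (enum ⟨j, hj⟩) h
  rwa [(hcode _ _).2, (hcode _ _).2] at h'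

/-! ### Cardinalities of the sorts of a hull -/

/-- A sort that is covered by the same finite set of variables in all interpretations and has the
same size in all of them keeps this size in the hull. -/
theorem mk_hull_of_covered {ι : Type w} (U : Ultrafilter ι) (A : ι → Interp Sg)
    {G : Sg.Sorts → Type u} (a : ∀ i σ, G σ → (A i).dom σ) {σ : Sg.Sorts} {X : Finset (Var Sg)}
    {c : Cardinal.{u}} (hc : ∀ i, Cardinal.mk ((A i).dom σ) = c)
    (hX : ∀ i, (A i).vals X σ = Set.univ) : Cardinal.mk ((hull U A a).dom σ) = c := by
  -- There are finitely many arrangements of `X`, so one of them holds almost everywhere.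
  have hE : ∃ E : Setoid X, ∀ᶠ i in U, (A i).Sat (arrangement X E) :=
    Ultrafilter.eventually_exists_iff.1 (Filter.Eventually.of_forall fun i =>
      ⟨(A i).ker X, (A i).sat_arrangement_ker X⟩)
  obtain ⟨E, hE⟩ := hE
  obtain ⟨i, hi⟩ := hE.exists
  have hp : SamePattern (hull U A a) (A i) X := SamePattern.of_sat ((sat_hull U A a).2 hE) hi
  have hall : (hull U A a).vals X σ = Set.univ := by
    refine Set.eq_univ_of_forall fun q => ?_
    induction q using Quotient.inductionOn with | _ e
    have : ∀ᶠ i in U, ∃ x : X, ∃ h : x.1.1 = σ, h ▸ (A i).val x.1 = e.eval (A i) (a i) := by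
      refine Filter.Eventually.of_forall fun i => ?_
      have : e.eval (A i) (a i) ∈ (A i).vals X σ := by rw [hX]; trivial
      obtain ⟨n, hn, h⟩ := this
      exact ⟨⟨_, hn⟩, rfl, h⟩
    obtain ⟨⟨⟨τ, n⟩, hn⟩, h⟩ := Ultrafilter.eventually_exists_iff.1 this
    obtain ⟨_, hτ, _⟩ := h.exists
    dsimp only at hτ
    subst hτ
    refine ⟨n, hn, (hull_mk_eq U A a).2 (h.mono ?_)⟩
    rintro i ⟨_, h⟩
    exact h
  rw [← Cardinal.mk_univ, ← hall, hp.mk_vals_eq, hX, Cardinal.mk_univ, hc]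

/-- The number of values of slot terms filled with generators from sets of size at most `c`. -/
theorem mk_fillings_le (hSg : Sg.IsCountable) {I J : Type u} [Finite I] [Finite J]
    {c : Cardinal.{u}} (hc : Cardinal.aleph0 ≤ c) (L : I → Type u)
    (hL : ∀ i, Cardinal.aleph0 ≤ Cardinal.mk (L i) ∧ Cardinal.mk (L i) ≤ c) (σ : Sg.Sorts) :
    Cardinal.mk (SlotTerm Sg σ × (∀ i, Finset (L i)) × (J → ℕ)) ≤ c := by
  have h₁ : Cardinal.mk (SlotTerm Sg σ) ≤ c := by
    have := countable_skolemTerm hSg (G := fun _ => ULift.{u} ℕ)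
    have : Countable (SlotTerm Sg σ) :=
      (sigma_mk_injective (i := σ) (β := fun σ => SlotTerm Sg σ)).countable
    exact (Cardinal.mk_le_aleph0_iff.2 this).trans hc
  have h₂ : Cardinal.mk (∀ i, Finset (L i)) ≤ c := by
    rw [Cardinal.mk_pi]
    refine (Cardinal.prod_le_prod _ (fun _ => c) fun i => ?_).trans ?_
    · have : Infinite (L i) := Cardinal.infinite_iff.2 (hL i).1
      rw [Cardinal.mk_finset_of_infinite]
      exact (hL i).2
    · rw [Cardinal.prod_const']
      exact Cardinal.pow_le hc (Cardinal.lt_aleph0_of_finite I)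
  have h₃ : Cardinal.mk (J → ℕ) ≤ c :=
    (Cardinal.mk_le_aleph0_iff.2 inferInstance).trans hc
  rw [Cardinal.mk_prod, Cardinal.mk_prod, Cardinal.lift_id, Cardinal.lift_id, Cardinal.lift_id,
    Cardinal.lift_id]
  exact Cardinal.mul_le_of_le hc h₁ (Cardinal.mul_le_of_le hc h₂ h₃)

/-- A many-sorted Löwenheim–Skolem theorem: from interpretations with property `P` and sorts in
`J` of arbitrary large finite sizes one gets a hull in which the sorts in `J` have prescribed
infinite cardinalities. -/
theorem exists_hull_mk_eq (hSg : Sg.IsCountable) {P : Interp Sg → Prop} {J : Set Sg.Sorts}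
    (hJ : J.Finite) {n₀ : ℕ}
    (hP : ∀ n : J → ℕ, (∀ j, n₀ ≤ n j) → ∃ A, P A ∧ ∀ j : J, Cardinal.mk (A.dom j) = n j)
    (κ : Sg.Sorts → Cardinal.{u}) (hκ : ∀ j ∈ J, Cardinal.aleph0 ≤ κ j) :
    ∃ (ι : Type u) (U : Ultrafilter ι) (A : ι → Interp Sg) (G : Sg.Sorts → Type u)
      (a : ∀ i σ, G σ → (A i).dom σ), (∀ i, P (A i)) ∧
      ∀ j ∈ J, Cardinal.mk ((hull U A a).dom j) = κ j := by
  classical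
  let L : Sg.Sorts → Type u := fun σ => (κ σ).ord.ToType
  have hL : ∀ σ, Cardinal.mk (L σ) = κ σ := fun σ => Cardinal.mk_ord_toType _
  let ι := Finset (Σ σ, SlotTerm Sg σ) × ∀ σ, Finset (L σ)
  choose A hA a hinj hind using fun i : ι => exists_indiscernible hJ hP κ (L := L) i.1 i.2
  -- Each index is a finite stage of terms and generators. An ultrafilter finer than `atTop` makes
  -- every given stage be included almost everywhere.
  let U : Ultrafilter ι := Ultrafilter.of Filter.atTop
  have hU : ∀ i₀ : ι, ∀ᶠ i in (U : Filter ι), i₀ ≤ i := fun i₀ =>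
    Ultrafilter.of_le _ (Filter.eventually_ge_atTop i₀)
  refine ⟨ι, U, A, fun σ => Option (L σ), a, hA, fun j hj => le_antisymm ?_ ?_⟩
  · let I := {σ // σ ∈ J ∧ κ σ ≤ κ j}
    have : Finite I := (hJ.subset fun σ (h : σ ∈ J ∧ κ σ ≤ κ j) => h.1).to_subtype
    have := hJ.to_subtype
    refine le_trans ?_ (mk_fillings_le hSg (hκ j hj) (I := I) (J := J) (fun i => L i)
      (fun i => by rw [hL]; exact ⟨hκ i i.2.1, i.2.2⟩) j)
    have hrep : ∀ q : (hull U A a).dom j, ∃ (F : ∀ σ, Finset (L σ)) (e : SlotTerm Sg j),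
        Quotient.mk (hullSetoid U A a j) (e.fill F) = q := by
      intro q
      induction q using Quotient.inductionOn with | _ d
      obtain ⟨F, hF⟩ := d.exists_fill
      obtain ⟨e, rfl⟩ := hF F le_rfl
      exact ⟨F, e, rfl⟩
    choose F e hFe using hrep
    -- By indiscernibility an element is determined by its slot term, its generators in sorts with
    -- `κ` at most `κ j`, and the mere number of generators in each sort of `J`.
    refine Cardinal.mk_le_of_injective
      (f := fun q => (e q, fun i : I => F q i, fun i : J => (F q i).card)) fun q q' h => ?_
    simp only [Prod.mk.injEq] at h
    obtain ⟨he, hF, hcard⟩ := h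
    rw [← hFe q, ← hFe q']
    refine (hull_mk_eq U A a).2 ?_
    filter_upwards [hU ({⟨j, e q⟩}, F q ⊔ F q')] with i hi
    rw [← he]
    refine hind i j hj (e q) (hi.1 (Finset.mem_singleton_self _)) _ _ fun k hk =>
      ⟨?_, ?_, congrFun hcard ⟨k, hk⟩, fun hle => congrFun hF ⟨k, hk, hle⟩⟩
    · exact (le_sup_left : F q ≤ F q ⊔ F q').trans hi.2 k
    · exact (le_sup_right : F q' ≤ F q ⊔ F q').trans hi.2 k
  · rw [← hL j]
    refine Cardinal.mk_le_of_injective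
      (f := fun g => Quotient.mk (hullSetoid U A a j) (.gen (some g))) fun g g' h => ?_
    obtain ⟨i, hi, hle⟩ := (((hull_mk_eq U A a).1 h).and (hU (∅, Function.update ⊥ j {g, g'}))).exists
    have hsub : {g, g'} ⊆ i.2 j := by
      have : Function.update (⊥ : ∀ σ, Finset (L σ)) j {g, g'} j ⊆ i.2 j := hle.2 j
      rwa [Function.update_self] at this
    exact hinj i j hj (hsub (by simp)) (hsub (by simp)) hi

/-! ### Smoothness over countable signatures -/

namespace Theory

variable {T : Theory Sg} {S : Set Sg.Sorts}

/-- Stable finiteness supplies a finite starting model, and finite smoothness enlarges it to the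
prescribed size in the sorts with finite `κ` and to arbitrary large finite sizes in the others.
Spare variables covering the former let both kinds of sorts be controlled in one hull. -/
theorem StablyFinite.smooth (h : T.StablyFinite S) (hfs : T.FinitelySmooth S) (hS : S.Finite)
    (hSg : Sg.IsCountable) : T.Smooth S := by
  classical
  intro φ hφ A hA hs κ hκ
  obtain ⟨B, hB, hBs, hBc⟩ := h φ hφ A hA hs
  have hBκ : ∀ σ : S, Cardinal.mk (B.dom σ) ≤ κ σ := fun σ => (hBc σ σ.2).2.trans (hκ σ)
  have hκpos : ∀ σ : S, κ σ ≠ 0 := fun σ => by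
    have := B.dom_nonempty σ
    exact (lt_of_lt_of_le (Cardinal.mk_ne_zero (B.dom σ)).bot_lt (hBκ σ)).ne'
  let κ' : Sg.Sorts → Cardinal.{u} := fun σ => if hσ : σ ∈ S then κ ⟨σ, hσ⟩ else 0
  have hκ' : ∀ σ : S, κ' σ = κ σ := fun σ => dif_pos σ.2
  let J : Set Sg.Sorts := {σ | σ ∈ S ∧ Cardinal.aleph0 ≤ κ' σ}
  let F : Finset Sg.Sorts := hS.toFinset.filter fun σ => κ' σ < Cardinal.aleph0
  have hmemF : ∀ {σ}, σ ∈ F ↔ σ ∈ S ∧ κ' σ < Cardinal.aleph0 := by simp [F]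
  -- spare variables to cover the finite sorts
  obtain ⟨M, hM⟩ := exists_bound_index φ.vars
  -- Enough spare variables for the largest of the finite target sizes.
  let K := F.sup fun σ => Cardinal.toNat (κ' σ)
  let X := block F M K
  let P : Interp Sg → Prop := fun C => T.Models C ∧ C.Sat φ ∧ ∀ σ ∈ F,
    Cardinal.mk (C.dom σ) = κ' σ ∧ C.vals X σ = Set.univ
  have hn₀ : ∃ n₀ : ℕ, ∀ σ ∈ S, Cardinal.mk (B.dom σ) ≤ n₀ := by
    choose! n hn using fun σ hσ => Cardinal.lt_aleph0.1 (hBc σ hσ).1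
    refine ⟨hS.toFinset.sup n, fun σ hσ => ?_⟩
    rw [hn σ hσ]
    exact_mod_cast Finset.le_sup (hS.mem_toFinset.2 hσ)
  obtain ⟨n₀, hn₀⟩ := hn₀
  have hP : ∀ n : J → ℕ, (∀ j, n₀ ≤ n j) →
      ∃ C, P C ∧ ∀ j : J, Cardinal.mk (C.dom j) = n j := by
    intro n hn
    obtain ⟨C, hC, hCs, hCc⟩ := hfs φ hφ B hB hBs
      (fun σ => if hσ : (σ : Sg.Sorts) ∈ J then (n ⟨σ, hσ⟩ : Cardinal) else κ' σ) (fun σ => by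
        split_ifs with hσ
        · exact (hn₀ σ σ.2).trans (by exact_mod_cast hn ⟨σ, hσ⟩)
        · rw [hκ']; exact hBκ σ) (fun σ => by
        split_ifs with hσ
        · exact Cardinal.natCast_lt_aleph0
        · exact not_le.1 fun hle => hσ ⟨σ.2, hle⟩)
    have hCF : ∀ σ ∈ F, Cardinal.mk (C.dom σ) = κ' σ := fun σ hσ =>
      (hCc ⟨σ, (hmemF.1 hσ).1⟩).trans (dif_neg fun hJ => (hmemF.1 hσ).2.not_ge hJ.2)
    obtain ⟨v, hv, hvX⟩ := C.exists_fill (V := ∅) (S := F) (M := M) (K := K)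
      (fun σ => Set.univ) fun σ hσ => by
        have := C.dom_nonempty σ
        refine ⟨?_, Set.univ_nonempty, ?_, Set.subset_univ _⟩
        · rw [← Cardinal.lt_aleph0_iff_set_finite, Cardinal.mk_univ, hCF σ hσ]
          exact (hmemF.1 hσ).2
        · rw [Set.ncard_univ, Nat.card, hCF σ hσ]
          exact Finset.le_sup (f := fun σ => Cardinal.toNat (κ' σ)) hσ
    refine ⟨C.withVal v, ⟨hC.withVal v, (Interp.sat_withVal_iff fun x hx => hv x fun hb => ?_).2
      hCs, fun σ hσ => ⟨hCF σ hσ, ?_⟩⟩, fun j => ?_⟩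
    · have := (mem_block.1 hb).2.1
      have := hM x hx
      omega
    · have := hvX σ hσ
      rwa [Finset.empty_union] at this
    · exact (hCc ⟨j, j.2.1⟩).trans (dif_pos j.2)
  obtain ⟨ι, U, D, G, a, hD, hJc⟩ := exists_hull_mk_eq hSg (hS.subset fun σ hσ => hσ.1) hP κ'
    fun j hj => hj.2
  refine ⟨hull U D a, models_hull _ _ _ fun i => (hD i).1,
    (sat_hull _ _ _).2 (Filter.Eventually.of_forall fun i => (hD i).2.1), fun σ => ?_⟩
  rw [← hκ']
  by_cases hσ : (σ : Sg.Sorts) ∈ J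
  · exact hJc σ hσ
  · have hσF : (σ : Sg.Sorts) ∈ F := hmemF.2 ⟨σ.2, not_le.1 fun hle => hσ ⟨σ.2, hle⟩⟩
    exact mk_hull_of_covered U D a (fun i => ((hD i).2.2 σ hσF).1) fun i => ((hD i).2.2 σ hσF).2

theorem Smooth.finitelySmooth (h : T.Smooth S) : T.FinitelySmooth S :=
  fun φ hφ A hA hs κ hκ _ => h φ hφ A hA hs κ hκ

theorem Smooth.stablyInfinite (h : T.Smooth S) : T.StablyInfinite S := by
  rintro φ hφ ⟨A, hA, hs⟩
  obtain ⟨B, hB, hBs, hBc⟩ := h φ hφ A hA hs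
    (fun σ => max (Cardinal.mk (A.dom σ)) Cardinal.aleph0) fun σ => le_max_left _ _
  exact ⟨B, hB, hBs, fun σ hσ => (le_max_right _ _).trans_eq (hBc ⟨σ, hσ⟩).symm⟩

end Theory

end ManySorted

theorem mainTheorem9 (Sg : ManySorted.Signature.{u}) (T : ManySorted.Theory Sg)
    (S : Set Sg.Sorts) (hS : S.Finite) :
    ((T.StablyFinite S ∧ T.FinitelySmooth S) ↔ (T.StablyInfinite S ∧ T.HasStrongPreWitness S)) ∧
    ((T.StablyFinite S ∧ T.Smooth S) ↔ (T.Smooth S ∧ T.HasStrongPreWitness S)) ∧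
    (Sg.IsCountable →
      List.TFAE
        [T.StablyFinite S ∧ T.FinitelySmooth S,
         T.StablyInfinite S ∧ T.HasStrongPreWitness S,
         T.StablyFinite S ∧ T.Smooth S,
         T.Smooth S ∧ T.HasStrongPreWitness S]) := by
  have h₁ : (T.StablyFinite S ∧ T.FinitelySmooth S) ↔
      (T.StablyInfinite S ∧ T.HasStrongPreWitness S) :=
    ⟨fun h => ⟨h.1.stablyInfinite h.2 hS, h.1.hasStrongPreWitness h.2 hS⟩,
      fun h => ⟨h.2.stablyFinite, h.2.finitelySmooth hS h.1⟩⟩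
  have h₂ : (T.StablyFinite S ∧ T.Smooth S) ↔ (T.Smooth S ∧ T.HasStrongPreWitness S) :=
    ⟨fun h => ⟨h.2, h.1.hasStrongPreWitness h.2.finitelySmooth hS⟩,
      fun h => ⟨h.2.stablyFinite, h.1⟩⟩
  refine ⟨h₁, h₂, fun hSg => ?_⟩
  -- Countability of the signature enters only here: it keeps the slot terms from outnumbering an
  -- infinite `κ`.
  have h₃ : (T.StablyFinite S ∧ T.FinitelySmooth S) ↔ (T.StablyFinite S ∧ T.Smooth S) :=
    ⟨fun h => ⟨h.1, h.1.smooth h.2 hS hSg⟩, fun h => ⟨h.1, h.2.finitelySmooth⟩⟩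
  tfae_have 1 ↔ 2 := h₁
  tfae_have 3 ↔ 4 := h₂
  tfae_have 1 ↔ 3 := h₃
  tfae_finish
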